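/- Let $G$ be a locally compact (Hausdorff) group with left Haar measure $dx$ and let $\mathcal H=L^2(G)$. Let $M=L^\infty(G)\subseteq\mathcal B(\mathcal H)$, acting by multiplication operators $\pi_f\xi=f\xi$, with left Haar weight $\varphi(\pi_f)=\int f(x)\,dx$. For $b\in C_c(G)$ let $(L_b\xi)(x)=\int b(z)\xi(z^{-1}x)\,dz$, and let $\hat M=\mathcal L(G)$ be the von Neumann algebra generated by $L(C_c(G))$, with left Haar weight $\hat\varphi$ the Plancherel weight: $\hat\varphi(S^*S)=\|\xi\|_2^2$ if $S\in\hat M$ is left convolution by $\xi\in L^2(G)$ (that is, $Sg=\xi*g$ for $g\in C_c(G)$), and $\hat\varphi(T)=\infty$ for positive $T\in\hat M$ not of the form $S^*S$ with such an $S$. Both weights are extended linearly to the spans $\mathfrak M_\varphi$, $\mathfrak M_{\hat\varphi}$ of the positive elements of finite weight. Let $W$ be the multiplicative unitary on $\mathcal H\otimes\mathcal H=L^2(G\times G)$, $(W\zeta)(x,y)=\zeta(x,x^{-1}y)$. The dual pairing of $b=(\omega\otimes\mathrm{id})(W)$, $\omega\in M_*$, with $a\in M$ is $\langle b\,|\,a\rangle=\omega(a)$;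 for $a=(\mathrm{id}\otimes\theta)(W)$ with $\theta\in\hat M_*$ this is also $(\omega\otimes\theta)(W)=\theta(b)$. For $X\in M\otimes\hat M$ write $Y=(\mathrm{id}\otimes\hat\varphi)(X)$ if $Y\in M$ satisfies $\omega(Y)=\hat\varphi((\omega\otimes\mathrm{id})(X))$ for all $\omega\in M_*$ with $(\omega\otimes\mathrm{id})(X)\in\mathfrak M_{\hat\varphi}$ and these $\omega$ are dense in $M_*$; define $(\varphi\otimes\mathrm{id})(X)\in\hat M$ in the same way, and say that $(\varphi\otimes\hat\varphi)(X)=v$ if both $\varphi((\mathrm{id}\otimes\hat\varphi)(X))$ and $\hat\varphi((\varphi\otimes\mathrm{id})(X))$ are defined and equal to $v$. Put $\mathcal F(a)=(\varphi\otimes\mathrm{id})(W(a\otimes 1))$ and $\mathcal F^{-1}(b)=(\mathrm{id}\otimes\hat\varphi)(W^*(1\otimes b))$. Then for all $a,b\in C_c(G)$ all of the following expressions are defined and $$\langle L_b\,|\,\pi_a\rangle=(\varphi\otimes\hat\varphi)\bigl[(\pi_a\otimes 1)W^*(1\otimes L_b)\bigr]=\varphi\bigl(\pi_a\mathcal F^{-1}(L_b)\bigr)=\hat\varphi\bigl(\mathcal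 F(\pi_a^*)^*L_b\bigr)=\int_G a(x)b(x)\,dx .$$ -/

import Mathlib

open MeasureTheory Filter Topology
open scoped ENNReal InnerProductSpace TensorProduct CompactlySupported

set_option linter.unusedSectionVars false

noncomputable section

namespace LCQG

section HilbertSpaces

variable {G : Type*} [MeasurableSpace G]

/-- The Hilbert space `L²(G)`. -/
abbrev L2 (μ : Measure G) : Type _ := Lp ℂ 2 μ

/-- The Hilbert space `L²(G; L²(G))`, which is the Hilbert space tensor product `L²(G) ⊗ L²(G)`:
the elementary tensor `ξ ⊗ η` is the function `x ↦ ξ(x) η`. A vector `ζ` of `L²(G × G)` corresponds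
to the function `x ↦ ζ(x, ·)`. (Unlike the product measure, this model needs no countability
assumption on `G`.) -/
abbrev L2L2 (μ : Measure G) : Type _ := Lp (L2 μ) 2 μ

variable {μ : Measure G}

/-- The elementary tensor `ξ ⊗ η`, that is, the function `x ↦ ξ(x) η`. -/
def tmul (ξ η : L2 μ) : L2L2 μ := (ContinuousLinearMap.toSpanSingleton ℂ η).compLp ξ

theorem coeFn_tmul (ξ η : L2 μ) : (tmul ξ η : G → L2 μ) =ᵐ[μ] fun x => ξ x • η := by
  filter_upwards [(ContinuousLinearMap.toSpanSingleton ℂ η).coeFn_compLp ξ] with x hx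
  simpa [tmul] using hx

theorem inner_tmul_tmul (ξ η ξ' η' : L2 μ) :
    ⟪tmul ξ η, tmul ξ' η'⟫_ℂ = ⟪ξ, ξ'⟫_ℂ * ⟪η, η'⟫_ℂ := by
  rw [L2.inner_def, L2.inner_def (𝕜 := ℂ) ξ ξ', ← integral_mul_const]
  refine integral_congr_ae ?_
  filter_upwards [coeFn_tmul ξ η, coeFn_tmul ξ' η'] with x h1 h2
  rw [h1, h2, inner_smul_left, inner_smul_right]
  simp only [RCLike.inner_apply]
  ring

/-- The algebraic tensor product of `L²(G)` with itself, sitting inside `L²(G; L²(G))`. -/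
def tensorEmbₗ (μ : Measure G) : (L2 μ ⊗[ℂ] L2 μ) →ₗ[ℂ] L2L2 μ :=
  TensorProduct.lift <| LinearMap.mk₂ ℂ tmul
    (fun ξ ξ' η => (ContinuousLinearMap.toSpanSingleton ℂ η).compLpL 2 μ |>.map_add ξ ξ')
    (fun c ξ η => (ContinuousLinearMap.toSpanSingleton ℂ η).compLpL 2 μ |>.map_smul c ξ)
    (fun ξ η η' => by
      apply Lp.ext
      filter_upwards [coeFn_tmul ξ (η + η'), coeFn_tmul ξ η, coeFn_tmul ξ η',
        Lp.coeFn_add (tmul ξ η) (tmul ξ η')] with x h1 h2 h3 h4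
      rw [h1, h4, Pi.add_apply, h2, h3, smul_add])
    (fun c ξ η => by
      apply Lp.ext
      filter_upwards [coeFn_tmul ξ (c • η), coeFn_tmul ξ η,
        Lp.coeFn_smul c (tmul ξ η)] with x h1 h2 h3
      rw [h1, h3, Pi.smul_apply, h2, smul_comm])

theorem inner_tensorEmbₗ (s t : L2 μ ⊗[ℂ] L2 μ) :
    ⟪tensorEmbₗ μ s, tensorEmbₗ μ t⟫_ℂ = ⟪s, t⟫_ℂ := by
  induction s using TensorProduct.induction_on with
  | zero => simp
  | add s s' hs hs' => simp [inner_add_left, hs, hs']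
  | tmul ξ η =>
    induction t using TensorProduct.induction_on with
    | zero => simp
    | add t t' ht ht' => simp only [map_add, inner_add_right, ht, ht']
    | tmul ξ' η' =>
      rw [TensorProduct.inner_tmul]
      exact inner_tmul_tmul ξ η ξ' η'

/-- The isometric embedding of the algebraic tensor product of `L²(G)` with itself into
`L²(G; L²(G))`. -/
def tensorEmb (μ : Measure G) : (L2 μ ⊗[ℂ] L2 μ) →ₗᵢ[ℂ] L2L2 μ :=
  (tensorEmbₗ μ).isometryOfInner inner_tensorEmbₗ

theorem tensorEmb_tmul (ξ η : L2 μ) : tensorEmb μ (ξ ⊗ₜ η) = tmul ξ η := rfl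

theorem denseRange_tensorEmb (μ : Measure G) : DenseRange (tensorEmb μ) := by
  intro f
  refine Lp.induction (p := 2) (by simp)
    (motive := fun f : L2L2 μ => f ∈ closure (Set.range (tensorEmb μ))) ?_ ?_ ?_ f
  · intro c s hs hμs
    apply subset_closure
    refine ⟨(indicatorConstLp 2 hs hμs.ne (1 : ℂ)) ⊗ₜ c, ?_⟩
    rw [tensorEmb_tmul, Lp.simpleFunc.coe_indicatorConst]
    apply Lp.ext
    filter_upwards [coeFn_tmul (indicatorConstLp 2 hs hμs.ne (1 : ℂ)) c,
      indicatorConstLp_coeFn (p := 2) (hs := hs) (hμs := hμs.ne) (c := (1 : ℂ)),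
      indicatorConstLp_coeFn (p := 2) (hs := hs) (hμs := hμs.ne) (c := c)] with x h1 h2 h3
    rw [h1, h2, h3]
    by_cases hx : x ∈ s <;> simp [hx]
  · intro f g hf hg _ h1 h2
    exact (LinearMap.range (tensorEmb μ).toLinearMap).topologicalClosure.add_mem h1 h2
  · exact isClosed_closure

/-- The operator `A ⊗ B` on `L²(G) ⊗ L²(G)`, the continuous extension of the operator on the
algebraic tensor product. -/
def tensorOp (A B : L2 μ →L[ℂ] L2 μ) : L2L2 μ →L[ℂ] L2L2 μ :=
  ((tensorEmb μ).toContinuousLinearMap ∘L TensorProduct.mapL A B).extend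
    (tensorEmb μ).toContinuousLinearMap

theorem tensorOp_tmul (A B : L2 μ →L[ℂ] L2 μ) (ξ η : L2 μ) :
    tensorOp A B (tmul ξ η) = tmul (A ξ) (B η) :=
  ContinuousLinearMap.extend_eq _ (denseRange_tensorEmb μ)
    (tensorEmb μ).isometry.isUniformInducing (ξ ⊗ₜ η)

/-- The operator `η ↦ ξ ⊗ η`. -/
def tmulLeft (ξ : L2 μ) : L2 μ →L[ℂ] L2L2 μ :=
  (tensorEmb μ).toContinuousLinearMap ∘L TensorProduct.mkL ℂ (L2 μ) (L2 μ) ξ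

/-- The operator `ξ ↦ ξ ⊗ η`. -/
def tmulRight (η : L2 μ) : L2 μ →L[ℂ] L2L2 μ :=
  (tensorEmb μ).toContinuousLinearMap ∘L (TensorProduct.mkL ℂ (L2 μ) (L2 μ)).flip η

end HilbertSpaces

section NormalFunctionals

variable {G : Type*} [MeasurableSpace G]

/-- A normal functional `ω = ∑ₙ ⟨· ξₙ, ηₙ⟩` on `B(L²(G))`, with `∑ₙ ‖ξₙ‖² < ∞` and
`∑ₙ ‖ηₙ‖² < ∞`, given by the two sequences of vectors. Every normal functional on `B(L²(G))` is of
this form, and the normal functionals on a von Neumann algebra `N ⊆ B(L²(G))` are the restrictions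
of those on `B(L²(G))`. (In Mathlib `⟪·, ·⟫` is linear in the second variable.) -/
structure NormalFunctional (μ : Measure G) where
  /-- the vectors `ξₙ` -/
  ket : ℕ → L2 μ
  /-- the vectors `ηₙ` -/
  bra : ℕ → L2 μ
  summable_ket : Summable fun n => ‖ket n‖ ^ 2
  summable_bra : Summable fun n => ‖bra n‖ ^ 2

namespace NormalFunctional

variable {μ : Measure G}

/-- The value `ω(T) = ∑ₙ ⟨T ξₙ, ηₙ⟩`. -/
def eval (ω : NormalFunctional μ) (T : L2 μ →L[ℂ] L2 μ) : ℂ :=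
  ∑' n, ⟪ω.bra n, T (ω.ket n)⟫_ℂ

/-- The slice `(ω ⊗ id)(X)`, a norm convergent series of slices by vector functionals:
`⟨(ω ⊗ id)(X) η, η'⟩ = ∑ₙ ⟨X (ξₙ ⊗ η), ηₙ ⊗ η'⟩`. -/
def sliceLeft (ω : NormalFunctional μ) (X : L2L2 μ →L[ℂ] L2L2 μ) : L2 μ →L[ℂ] L2 μ :=
  ∑' n, (tmulLeft (ω.bra n)).adjoint ∘L X ∘L tmulLeft (ω.ket n)

/-- The slice `(id ⊗ θ)(X)`. -/
def sliceRight (θ : NormalFunctional μ) (X : L2L2 μ →L[ℂ] L2L2 μ) : L2 μ →L[ℂ] L2 μ :=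
  ∑' n, (tmulRight (θ.bra n)).adjoint ∘L X ∘L tmulRight (θ.ket n)

/-- The value `(ω ⊗ θ)(X)`. -/
def evalTensor (ω θ : NormalFunctional μ) (X : L2L2 μ →L[ℂ] L2L2 μ) : ℂ :=
  ∑' p : ℕ × ℕ, ⟪tmul (ω.bra p.1) (θ.bra p.2), X (tmul (ω.ket p.1) (θ.ket p.2))⟫_ℂ

end NormalFunctional

end NormalFunctionals

section Weights

variable {G : Type*} [MeasurableSpace G] {μ : Measure G}

/-- The definition domain `𝔐_w` of a weight `w` on `N`: the linear span of the positive elements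
`S` of `N` with `w(S) < ∞`. -/
def weightDomain (N : Set (L2 μ →L[ℂ] L2 μ)) (w : (L2 μ →L[ℂ] L2 μ) → ℝ≥0∞) :
    Submodule ℂ (L2 μ →L[ℂ] L2 μ) :=
  Submodule.span ℂ {S | S ∈ N ∧ S.IsPositive ∧ w S < ∞}

/-- `T ∈ 𝔐_w` and `w(T) = v`, where the weight `w` on `N` is extended (uniquely) to a linear
functional on `𝔐_w`. -/
def HasWeight (N : Set (L2 μ →L[ℂ] L2 μ)) (w : (L2 μ →L[ℂ] L2 μ) → ℝ≥0∞)
    (T : L2 μ →L[ℂ] L2 μ) (v : ℂ) : Prop :=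
  ∃ (hT : T ∈ weightDomain N w) (Φ : weightDomain N w →ₗ[ℂ] ℂ),
    (∀ S (hS : S ∈ N ∧ S.IsPositive ∧ w S < ∞),
      Φ ⟨S, Submodule.subset_span hS⟩ = ((w S).toReal : ℂ)) ∧
    Φ ⟨T, hT⟩ = v

end Weights

section Group

variable {G : Type*} [Group G] [TopologicalSpace G] [IsTopologicalGroup G] [LocallyCompactSpace G]
  [T2Space G] [MeasurableSpace G] [BorelSpace G]
variable (μ : Measure G) [μ.IsHaarMeasure] [μ.Regular]

instance instContinuousSMul : ContinuousSMul Gᵈᵐᵃ (L2 μ) :=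
  haveI : Fact ((2 : ℝ≥0∞) ≠ ∞) := ⟨by simp⟩
  inferInstance

/-- Left translation on `L²(G)`: `(λ_z ξ)(x) = ξ(z⁻¹ x)`. -/
def translate (z : G) (ξ : L2 μ) : L2 μ := DomMulAct.mk z⁻¹ • ξ

theorem coeFn_translate (z : G) (ξ : L2 μ) :
    (translate μ z ξ : G → ℂ) =ᵐ[μ] fun x => ξ (z⁻¹ * x) :=
  DomMulAct.smul_Lp_ae_eq _ ξ

theorem norm_translate (z : G) (ξ : L2 μ) : ‖translate μ z ξ‖ = ‖ξ‖ :=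
  DomMulAct.norm_smul_Lp _ _

theorem translate_add (z : G) (ξ η : L2 μ) :
    translate μ z (ξ + η) = translate μ z ξ + translate μ z η :=
  smul_add _ _ _

theorem translate_smul (z : G) (c : ℂ) (ξ : L2 μ) :
    translate μ z (c • ξ) = c • translate μ z ξ :=
  smul_comm _ _ _

theorem continuous_translate : Continuous fun p : G × L2 μ => translate μ p.1 p.2 :=
  ((DomMulAct.continuous_mk.comp continuous_fst.inv).smul continuous_snd)

/-- The multiplication operator `(π_f ξ)(x) = f(x) ξ(x)` on `L²(G)`, for `f ∈ L^∞(G)`. -/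
def mulOp (f : Lp ℂ ∞ μ) : L2 μ →L[ℂ] L2 μ :=
  (ContinuousLinearMap.lsmul ℂ ℂ).holderL μ ∞ 2 2 f

/-- The multiplication operator `π_a`, for `a ∈ C_c(G)`. -/
def piOp (a : C_c(G, ℂ)) : L2 μ →L[ℂ] L2 μ :=
  mulOp μ ((a.continuous.memLp_top_of_hasCompactSupport a.hasCompactSupport μ).toLp a)

theorem integrable_smul_translate (b : C_c(G, ℂ)) (ξ : L2 μ) :
    Integrable (fun z => b z • translate μ z ξ) μ := by
  apply Continuous.integrable_of_hasCompactSupport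
  · exact b.continuous.smul ((continuous_translate μ).comp (.prodMk continuous_id continuous_const))
  · exact b.hasCompactSupport.smul_right

/-- The convolution operator `(L_b ξ)(x) = ∫ b(z) ξ(z⁻¹ x) dz`, for `b ∈ C_c(G)`; that is,
`L_b ξ = ∫ b(z) λ_z ξ dz` in `L²(G)`. -/
def convOp (b : C_c(G, ℂ)) : L2 μ →L[ℂ] L2 μ :=
  LinearMap.mkContinuous
    { toFun := fun ξ => ∫ z, b z • translate μ z ξ ∂μ
      map_add' := fun ξ η => by
        rw [← integral_add (integrable_smul_translate μ b ξ) (integrable_smul_translate μ b η)]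
        simp only [translate_add, smul_add]
      map_smul' := fun c ξ => by
        rw [RingHom.id_apply, ← integral_smul]
        simp only [translate_smul, smul_comm c] }
    (∫ z, ‖b z‖ ∂μ) fun ξ => by
      refine (norm_integral_le_integral_norm _).trans_eq ?_
      simp only [norm_smul, norm_translate]
      exact integral_mul_const _ _

/-- The von Neumann algebra `M = L^∞(G)`, acting by multiplication operators on `L²(G)`. -/
def algM : Set (L2 μ →L[ℂ] L2 μ) := Set.range (mulOp μ)

/-- The group von Neumann algebra `M̂ = 𝓛(G)`, the von Neumann algebra generated by `L(C_c(G))`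
(the weak closure of this nondegenerate `*`-algebra, which is its bicommutant). -/
def algMhat : StarSubalgebra ℂ (L2 μ →L[ℂ] L2 μ) :=
  StarSubalgebra.centralizer ℂ
    (StarSubalgebra.centralizer ℂ (Set.range (convOp μ)) : Set (L2 μ →L[ℂ] L2 μ))

/-- The left Haar weight `φ(π_f) = ∫ f(x) dx` on the positive part of `L^∞(G)`. (The function `f` is
determined by the operator `π_f` up to a locally null set. Where this leaves a choice, which it can
do only if `G` is not `σ`-compact, the smallest value of the integral is taken; this is the supremum
of the integrals over compact sets.) -/
def haarWeight (T : L2 μ →L[ℂ] L2 μ) : ℝ≥0∞ :=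
  ⨅ (f : Lp ℂ ∞ μ) (_ : mulOp μ f = T), ∫⁻ x, ‖f x‖ₑ ∂μ

/-- The operator `T` is left convolution by the vector `ξ ∈ L²(G)`: one has `T g = ξ * g` for all
`g ∈ C_c(G)`. -/
def IsConvolutionBy (T : L2 μ →L[ℂ] L2 μ) (ξ : L2 μ) : Prop :=
  ∀ g : C_c(G, ℂ),
    (T ((g.continuous.memLp_of_hasCompactSupport g.hasCompactSupport).toLp g) : G → ℂ) =ᵐ[μ]
      fun x => ∫ y, ξ y * g (y⁻¹ * x) ∂μ

/-- The left Haar weight `φ̂` on the positive part of `𝓛(G)`, that is, the Plancherel weight: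
`φ̂(S* S) = ‖ξ‖²` if `S ∈ 𝓛(G)` is left convolution by the vector `ξ ∈ L²(G)`, and `φ̂(T) = ∞` if
`T` is not of the form `S* S` with such an `S`. Its GNS map takes `S` to `ξ`. -/
def plancherelWeight (T : L2 μ →L[ℂ] L2 μ) : ℝ≥0∞ :=
  ⨅ (S : L2 μ →L[ℂ] L2 μ) (ξ : L2 μ)
    (_ : S ∈ algMhat μ ∧ star S * S = T ∧ IsConvolutionBy μ S ξ), ENNReal.ofReal (‖ξ‖ ^ 2)

/-- `T ∈ 𝔐_φ` and `φ(T) = v`. -/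
def HasPhi (T : L2 μ →L[ℂ] L2 μ) (v : ℂ) : Prop :=
  HasWeight (algM μ) (haarWeight μ) T v

/-- `T ∈ 𝔐_φ̂` and `φ̂(T) = v`. -/
def HasPhihat (T : L2 μ →L[ℂ] L2 μ) (v : ℂ) : Prop :=
  HasWeight (algMhat μ) (plancherelWeight μ) T v

/-- Auxiliary fact for the multiplicative unitary: translating a constant vector on a set of finite
measure. -/
theorem aestronglyMeasurable_indicator_translate {s : Set G} (hs : MeasurableSet s)
    (hμs : μ s ≠ ∞) (ξ : L2 μ) :
    AEStronglyMeasurable (s.indicator fun x => translate μ x ξ) μ := by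
  rw [aestronglyMeasurable_indicator_iff hs]
  choose K hKs hK hμK using fun n : ℕ =>
    hs.exists_isCompact_sdiff_lt hμs (ε := ((n : ℝ≥0∞) + 1)⁻¹) (by simp)
  have h0 : μ (s \ ⋃ n, K n) = 0 := by
    refine le_antisymm (ge_of_tendsto' (x := atTop) (f := fun n : ℕ => ((n : ℝ≥0∞) + 1)⁻¹) ?_
      fun n => ?_) bot_le
    · have := ENNReal.tendsto_inv_nat_nhds_zero.comp (tendsto_add_atTop_nat 1)
      refine this.congr fun n => ?_
      simp
    · exact (measure_mono (Set.sdiff_subset_sdiff_right (Set.subset_iUnion K n))).trans (hμK n).le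
  have hcongr : s =ᵐ[μ] ⋃ n, K n :=
    (ae_le_set.2 h0).antisymm (Set.iUnion_subset hKs).eventuallyLE
  rw [Measure.restrict_congr_set hcongr, aestronglyMeasurable_iUnion_iff]
  intro n
  exact ((continuous_translate μ).comp
    (.prodMk continuous_id continuous_const)).continuousOn.aestronglyMeasurable_of_isCompact
    (hK n) (hK n).measurableSet

theorem aestronglyMeasurable_translate (f : L2L2 μ) :
    AEStronglyMeasurable (fun x => translate μ x (f x)) μ := by
  obtain ⟨u, hu, hlim⟩ := Lp.finStronglyMeasurable f (by simp) (by simp)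
  refine aestronglyMeasurable_of_tendsto_ae atTop (f := fun n x => translate μ x (u n x)) ?_ ?_
  · intro n
    have : (fun x => translate μ x (u n x)) =
        ∑ c ∈ (u n).range, (u n ⁻¹' {c}).indicator fun x => translate μ x c := by
      ext1 x
      rw [Finset.sum_apply, Finset.sum_eq_single (u n x)]
      · simp
      · intro c _ hc
        exact Set.indicator_of_notMem (by simpa using hc.symm) _
      · simp
    rw [this]
    refine Finset.aestronglyMeasurable_sum _ fun c _ => ?_
    by_cases hc : c = 0
    · have : ((u n ⁻¹' {c}).indicator fun x => translate μ x c) = fun _ => 0 := by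
        subst hc
        ext1 x
        simp [translate]
      rw [this]
      exact aestronglyMeasurable_const
    · refine aestronglyMeasurable_indicator_translate μ ((u n).measurableSet_fiber c) ?_ c
      refine ((measure_mono ?_).trans_lt (hu n)).ne
      intro x hx
      rw [Set.mem_preimage, Set.mem_singleton_iff] at hx
      simpa [hx] using hc
  · refine Eventually.of_forall fun x => ?_
    exact ((continuous_translate μ).comp
      (.prodMk continuous_const continuous_id)).continuousAt.tendsto.comp (hlim x)

theorem memLp_translate (f : L2L2 μ) : MemLp (fun x => translate μ x (f x)) 2 μ :=
  (Lp.memLp f).of_le (aestronglyMeasurable_translate μ f)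
    (Eventually.of_forall fun x => (norm_translate μ x (f x)).le)

/-- The multiplicative unitary `(W ζ)(x, y) = ζ(x, x⁻¹ y)`, that is, `(W ζ)(x) = λ_x (ζ(x))`. -/
def multUnitary : L2L2 μ →L[ℂ] L2L2 μ :=
  LinearIsometry.toContinuousLinearMap
    { toFun := fun f => (memLp_translate μ f).toLp _
      map_add' := fun f g => by
        apply Lp.ext
        filter_upwards [(memLp_translate μ (f + g)).coeFn_toLp, (memLp_translate μ f).coeFn_toLp,
          (memLp_translate μ g).coeFn_toLp, Lp.coeFn_add f g,
          Lp.coeFn_add ((memLp_translate μ f).toLp _) ((memLp_translate μ g).toLp _)]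
          with x h1 h2 h3 h4 h5
        rw [h1, h5, Pi.add_apply, h2, h3, h4, Pi.add_apply, translate_add]
      map_smul' := fun c f => by
        apply Lp.ext
        filter_upwards [(memLp_translate μ (c • f)).coeFn_toLp, (memLp_translate μ f).coeFn_toLp,
          Lp.coeFn_smul c f, Lp.coeFn_smul c ((memLp_translate μ f).toLp _)] with x h1 h2 h3 h4
        rw [RingHom.id_apply, h1, h4, Pi.smul_apply, h2, h3, Pi.smul_apply, translate_smul]
      norm_map' := fun f => by
        rw [Lp.norm_def, Lp.norm_def]
        congr 1
        refine eLpNorm_congr_norm_ae ?_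
        filter_upwards [(memLp_translate μ f).coeFn_toLp] with x h1
        exact (congrArg norm h1).trans (norm_translate μ x (f x)) }

theorem coeFn_multUnitary (f : L2L2 μ) :
    (multUnitary μ f : G → L2 μ) =ᵐ[μ] fun x => translate μ x (f x) :=
  (memLp_translate μ f).coeFn_toLp

/-- The dual pairing given by `W` has the value `⟨b | a⟩ = v`. For `b = (ω ⊗ id)(W)` it is
`⟨b | a⟩ = ω(a)`, and if `a = (id ⊗ θ)(W)` then it is also `(ω ⊗ θ)(W)` and `θ(b)`. -/
def HasDualPairing (b a : L2 μ →L[ℂ] L2 μ) (v : ℂ) : Prop :=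
  (∃ ω : NormalFunctional μ, ω.sliceLeft (multUnitary μ) = b) ∧
  ∀ ω : NormalFunctional μ, ω.sliceLeft (multUnitary μ) = b →
    ω.eval a = v ∧
    ∀ θ : NormalFunctional μ, θ.sliceRight (multUnitary μ) = a →
      ω.evalTensor θ (multUnitary μ) = v ∧ θ.eval b = v

/-- `Z = (φ ⊗ id)(X)` in `M̂`: one has `θ(Z) = φ((id ⊗ θ)(X))` for all normal functionals `θ` with
`(id ⊗ θ)(X) ∈ 𝔐_φ`, and these `θ` separate the points of `M̂` (that is, they are norm dense in
`M̂_*`), so that `Z` is unique. -/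
def IsSlicePhi (X : L2L2 μ →L[ℂ] L2L2 μ) (Z : L2 μ →L[ℂ] L2 μ) : Prop :=
  Z ∈ algMhat μ ∧
  (∀ θ : NormalFunctional μ, θ.sliceRight X ∈ weightDomain (algM μ) (haarWeight μ) →
    HasPhi μ (θ.sliceRight X) (θ.eval Z)) ∧
  ∀ T ∈ algMhat μ,
    (∀ θ : NormalFunctional μ, θ.sliceRight X ∈ weightDomain (algM μ) (haarWeight μ) →
      θ.eval T = 0) → T = 0

/-- `Y = (id ⊗ φ̂)(X)` in `M`: one has `ω(Y) = φ̂((ω ⊗ id)(X))` for all normal functionals `ω` with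
`(ω ⊗ id)(X) ∈ 𝔐_φ̂`, and these `ω` separate the points of `M` (that is, they are norm dense in
`M_*`), so that `Y` is unique. -/
def IsSlicePhihat (X : L2L2 μ →L[ℂ] L2L2 μ) (Y : L2 μ →L[ℂ] L2 μ) : Prop :=
  Y ∈ algM μ ∧
  (∀ ω : NormalFunctional μ, ω.sliceLeft X ∈ weightDomain (algMhat μ) (plancherelWeight μ) →
    HasPhihat μ (ω.sliceLeft X) (ω.eval Y)) ∧
  ∀ T ∈ algM μ,
    (∀ ω : NormalFunctional μ, ω.sliceLeft X ∈ weightDomain (algMhat μ) (plancherelWeight μ) →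
      ω.eval T = 0) → T = 0

/-- `Z` is the Fourier transform `𝓕(a) = (φ ⊗ id)(W (a ⊗ 1))`. -/
def IsFourier (a Z : L2 μ →L[ℂ] L2 μ) : Prop :=
  IsSlicePhi μ (multUnitary μ * tensorOp a 1) Z

/-- `Y` is the inverse Fourier transform `𝓕⁻¹(b) = (id ⊗ φ̂)(W* (1 ⊗ b))`. -/
def IsInvFourier (b Y : L2 μ →L[ℂ] L2 μ) : Prop :=
  IsSlicePhihat μ (star (multUnitary μ) * tensorOp 1 b) Y

/-- `(φ ⊗ φ̂)(X) = v`, where `φ ⊗ φ̂` is evaluated by slicing, in either order: both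
`φ((id ⊗ φ̂)(X))` and `φ̂((φ ⊗ id)(X))` are defined and equal to `v`. -/
def HasPhiTensorPhihat (X : L2L2 μ →L[ℂ] L2L2 μ) (v : ℂ) : Prop :=
  (∃ Y, IsSlicePhihat μ X Y ∧ HasPhi μ Y v) ∧ ∃ Z, IsSlicePhi μ X Z ∧ HasPhihat μ Z v

end Group

end LCQG

end

/-! The unitary `W` is the field of operators `x ↦ λ_x`: its matrix elements in the second leg are
multiplication by coefficient functions `x ↦ ⟨λ_x ξ, η⟩` or their conjugates. Hence every slice is
explicit. Integrating against `a(x) dx` in the first leg gives `𝓕(π_a) = L_a`, with the adjoint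
version giving `(φ ⊗ id)[(π_a ⊗ 1) W* (1 ⊗ L_b)] = (L_{star a})* L_b`. Slicing in the second leg
gives `𝓕⁻¹(L_b) = π_b`. All expressions then reduce to `φ(π_a π_b)`, to `φ̂((L_{star a})* L_b)`, or
to the pairing itself, and each equals `∫ a b`.

The analytic work is in controlling `φ̂`. Let `e` run through nonnegative symmetric bumps of
integral one shrinking to the unit. If `T` is left convolution by `ξ`, then `T e → ξ` in `L²`
(`tendsto_of_isConvolutionBy`), so `φ̂` is the limit of the vector functionals `⟨e, · e⟩` on its
domain (`hasPhihat_of_tendsto`). Symmetry of `e` makes `g ↦ g * e` an `L²` contraction whatever the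
modular function is. On the function side, coefficients of `e` against `b`, or against `L_b e`,
converge uniformly to `b` (`tendsto_coef_vec`, `tendsto_coef_convOp`), and normal functionals are
norm continuous, so these limits pass through every slice.

For the weight `φ`, an integrable symbol is determined almost everywhere by its multiplication
operator, even without σ-finiteness. Both weights are extended linearly by exhibiting a
single-valued linear relation (`HasWeight.of_relation`). -/

open scoped BoundedContinuousFunction

noncomputable section

namespace LCQG

/-! ### Compactly supported functions in `L²(G)`, coefficient functions and multiplication operators
-/

section

variable {G : Type*} [Group G] [TopologicalSpace G] [IsTopologicalGroup G] [LocallyCompactSpace G]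
  [T2Space G] [MeasurableSpace G] [BorelSpace G]
variable (μ : Measure G) [μ.IsHaarMeasure] [μ.Regular]

/-- The class in `L²(G)` of a compactly supported continuous function. -/
def vec (g : C_c(G, ℂ)) : L2 μ :=
  (g.continuous.memLp_of_hasCompactSupport g.hasCompactSupport).toLp g

theorem coeFn_vec (g : C_c(G, ℂ)) : (vec μ g : G → ℂ) =ᵐ[μ] g :=
  MemLp.coeFn_toLp _

theorem vec_sub (g h : C_c(G, ℂ)) : vec μ (g - h) = vec μ g - vec μ h := rfl

/-- The subspace of `L²(G)` of the classes of compactly supported continuous functions. -/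
def vecRange : Submodule ℂ (L2 μ) where
  carrier := Set.range (vec μ)
  add_mem' := by
    rintro _ _ ⟨g, rfl⟩ ⟨h, rfl⟩
    exact ⟨g + h, rfl⟩
  zero_mem' := ⟨0, Lp.ext (by
    filter_upwards [coeFn_vec μ 0, Lp.coeFn_zero ℂ 2 μ] with x h1 h2
    rw [h1, h2]
    rfl)⟩
  smul_mem' := by
    rintro c _ ⟨g, rfl⟩
    exact ⟨c • g, rfl⟩

/-- Squeeze a set `s` of finite measure between a compact `K` and an open `V`. A Urysohn function
for `K ⊆ V`, times `c`, differs from the indicator only on `V \ K`, and there by at most `‖c‖`. -/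
theorem denseRange_vec : DenseRange (vec μ) := by
  intro f
  refine Lp.induction (p := 2) (by simp)
    (motive := fun f : L2 μ => f ∈ closure (Set.range (vec μ))) ?_ ?_ ?_ f
  · intro c s hs hμs
    rw [Metric.mem_closure_range_iff]
    intro ε hε
    have hε2 : ENNReal.ofReal (ε / 2) ≠ 0 := by simpa using hε
    obtain ⟨δ, hδ, hδs⟩ := exists_eLpNorm_indicator_le (μ := μ) (p := 2) (by simp) c hε2
    have hδ2 : (δ : ℝ≥0∞) / 2 ≠ 0 := by simpa using hδ.ne'
    obtain ⟨V, hsV, hV, -, hμV⟩ := hs.exists_isOpen_sdiff_lt hμs.ne hδ2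
    obtain ⟨K, hKs, hK, hμK⟩ := hs.exists_isCompact_sdiff_lt hμs.ne hδ2
    obtain ⟨k, hk1, hkc, hkV, hk⟩ :=
      exists_continuousMap_one_of_isCompact_subset_isOpen hK hV (hKs.trans hsV)
    have hμ : μ (V \ K) ≤ δ := by
      have : V \ K ⊆ (V \ s) ∪ (s \ K) := fun x hx => by
        by_cases hxs : x ∈ s
        · exact Or.inr ⟨hxs, hx.2⟩
        · exact Or.inl ⟨hx.1, hxs⟩
      refine (measure_mono this).trans ((measure_union_le _ _).trans ?_)
      exact (add_le_add hμV.le hμK.le).trans_eq (ENNReal.add_halves _)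
    let g : C_c(G, ℂ) :=
      ⟨⟨fun x => (k x : ℂ) * c, by fun_prop⟩, HasCompactSupport.mul_right
        (HasCompactSupport.comp_left (f := k) hkc (g := Complex.ofReal) (by simp))⟩
    refine ⟨g, ?_⟩
    rw [Lp.simpleFunc.coe_indicatorConst, dist_eq_norm, Lp.norm_def]
    refine lt_of_le_of_lt (ENNReal.toReal_mono ENNReal.ofReal_ne_top
      (le_trans (eLpNorm_mono_ae ?_) (hδs _ hμ))) ?_
    · filter_upwards [Lp.coeFn_sub (indicatorConstLp 2 hs hμs.ne c) (vec μ g),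
        coeFn_vec μ g, indicatorConstLp_coeFn (p := 2) (hs := hs) (hμs := hμs.ne) (c := c)]
        with x h1 h2 h3
      rw [h1, Pi.sub_apply, h2, h3]
      change ‖s.indicator (fun _ => c) x - (k x : ℂ) * c‖ ≤ _
      have hb : ‖(k x : ℂ) * c‖ ≤ ‖c‖ := by
        rw [norm_mul, Complex.norm_real, Real.norm_of_nonneg (hk x).1]
        exact mul_le_of_le_one_left (norm_nonneg _) (hk x).2
      have hb' : ‖c - (k x : ℂ) * c‖ ≤ ‖c‖ := by
        rw [show c - (k x : ℂ) * c = ((1 - k x : ℝ) : ℂ) * c by push_cast; ring, norm_mul,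
          Complex.norm_real, Real.norm_of_nonneg (by linarith [(hk x).2])]
        exact mul_le_of_le_one_left (norm_nonneg _) (by linarith [(hk x).1])
      by_cases hxK : x ∈ K
      · simp [hKs hxK, hk1 hxK]
      · by_cases hxV : x ∈ V
        · rw [Set.indicator_of_mem (show x ∈ V \ K from ⟨hxV, hxK⟩)]
          by_cases hxs : x ∈ s
          · simpa [hxs] using hb'
          · simpa [hxs] using hb
        · have : k x = 0 := image_eq_zero_of_notMem_tsupport fun h => hxV (hkV h)
          simp [this, show x ∉ s from fun h => hxV (hsV h)]
    · rw [ENNReal.toReal_ofReal (by positivity)]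
      linarith
  · intro f g hf hg _ h1 h2
    exact (vecRange μ).topologicalClosure.add_mem h1 h2
  · exact isClosed_closure

theorem ext_inner_vec {ξ η : L2 μ} (h : ∀ g, ⟪vec μ g, ξ⟫_ℂ = ⟪vec μ g, η⟫_ℂ) : ξ = η := by
  refine ext_inner_left ℂ fun v => ?_
  refine (denseRange_vec μ).induction_on (p := fun v => ⟪v, ξ⟫_ℂ = ⟪v, η⟫_ℂ) v ?_ h
  exact isClosed_eq (by fun_prop) (by fun_prop)

theorem opext_vec {S T : L2 μ →L[ℂ] L2 μ}
    (h : ∀ g k, ⟪vec μ g, S (vec μ k)⟫_ℂ = ⟪vec μ g, T (vec μ k)⟫_ℂ) : S = T :=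
  ContinuousLinearMap.ext fun v => congrFun
    ((denseRange_vec μ).equalizer S.continuous T.continuous
      (funext fun k => ext_inner_vec μ fun g => h g k)) v

theorem opext_inner {S T : L2 μ →L[ℂ] L2 μ} (h : ∀ ξ η, ⟪ξ, S η⟫_ℂ = ⟪ξ, T η⟫_ℂ) : S = T :=
  ContinuousLinearMap.ext fun η => ext_inner_left ℂ fun ξ => h ξ η

theorem inner_vec_left (g : C_c(G, ℂ)) (ξ : L2 μ) :
    ⟪vec μ g, ξ⟫_ℂ = ∫ x, star (g x) * ξ x ∂μ := by
  rw [L2.inner_def]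
  refine integral_congr_ae ?_
  filter_upwards [coeFn_vec μ g] with x hx
  rw [hx, RCLike.inner_apply, mul_comm]
  rfl

theorem inner_vec_vec (g h : C_c(G, ℂ)) :
    ⟪vec μ g, vec μ h⟫_ℂ = ∫ x, star (g x) * h x ∂μ := by
  rw [inner_vec_left]
  refine integral_congr_ae ?_
  filter_upwards [coeFn_vec μ h] with x hx
  rw [hx]

/-- Left translation on `C_c(G)`. -/
def translateCc (z : G) (g : C_c(G, ℂ)) : C_c(G, ℂ) where
  toFun x := g (z⁻¹ * x)
  hasCompactSupport' := g.hasCompactSupport.comp_homeomorph (Homeomorph.mulLeft z⁻¹)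

theorem translateCc_apply (z : G) (g : C_c(G, ℂ)) (x : G) : translateCc z g x = g (z⁻¹ * x) := rfl

theorem translate_vec (z : G) (g : C_c(G, ℂ)) :
    translate μ z (vec μ g) = vec μ (translateCc z g) := by
  apply Lp.ext
  filter_upwards [coeFn_translate μ z (vec μ g), coeFn_vec μ (translateCc z g),
    (measurePreserving_mul_left μ z⁻¹).quasiMeasurePreserving.ae (coeFn_vec μ g)] with x h1 h2 h3
  rw [h1, h2, h3]
  rfl

theorem norm_inner_translate_le (ξ η : L2 μ) (x : G) :
    ‖⟪translate μ x ξ, η⟫_ℂ‖ ≤ ‖ξ‖ * ‖η‖ :=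
  (norm_inner_le_norm _ _).trans_eq (by rw [norm_translate])

/-- The coefficient function `x ↦ ⟨η, λ_x ξ⟩` of the left regular representation. -/
def coef (ξ η : L2 μ) : G →ᵇ ℂ :=
  .ofNormedAddCommGroup (fun x => ⟪translate μ x ξ, η⟫_ℂ)
    (((continuous_translate μ).comp (.prodMk continuous_id continuous_const)).inner
      continuous_const) (‖ξ‖ * ‖η‖) (norm_inner_translate_le μ ξ η)

theorem coef_apply (ξ η : L2 μ) (x : G) : coef μ ξ η x = ⟪translate μ x ξ, η⟫_ℂ := rfl

theorem norm_coef_le (ξ η : L2 μ) : ‖coef μ ξ η‖ ≤ ‖ξ‖ * ‖η‖ :=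
  BoundedContinuousFunction.norm_ofNormedAddCommGroup_le _ (by positivity) _

theorem star_coef_apply (ξ η : L2 μ) (x : G) : star (coef μ ξ η) x = ⟪η, translate μ x ξ⟫_ℂ := by
  rw [BoundedContinuousFunction.star_apply, coef_apply]
  exact inner_conj_symm _ _

theorem memLp_top (c : G →ᵇ ℂ) : MemLp c ∞ μ :=
  memLp_top_of_bound c.continuous.aestronglyMeasurable ‖c‖ (Eventually.of_forall c.norm_coe_le_norm)

/-- Multiplication by a bounded continuous function. -/
def bmul (c : G →ᵇ ℂ) : L2 μ →L[ℂ] L2 μ := mulOp μ ((memLp_top μ c).toLp c)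

theorem coeFn_mulOp (f : Lp ℂ ∞ μ) (ξ : L2 μ) :
    (mulOp μ f ξ : G → ℂ) =ᵐ[μ] fun x => f x * ξ x :=
  (ContinuousLinearMap.lsmul ℂ ℂ).coeFn_holder (r := 2) f ξ

theorem coeFn_bmul (c : G →ᵇ ℂ) (ξ : L2 μ) : (bmul μ c ξ : G → ℂ) =ᵐ[μ] fun x => c x * ξ x := by
  filter_upwards [coeFn_mulOp μ ((memLp_top μ c).toLp c) ξ, (memLp_top μ c).coeFn_toLp]
    with x h1 h2
  rw [← h2]
  exact h1

theorem coeFn_piOp (a : C_c(G, ℂ)) (ξ : L2 μ) : (piOp μ a ξ : G → ℂ) =ᵐ[μ] fun x => a x * ξ x := by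
  filter_upwards [coeFn_mulOp μ _ ξ,
    (a.continuous.memLp_top_of_hasCompactSupport a.hasCompactSupport μ).coeFn_toLp]
    with x h1 h2
  exact h1.trans (congrArg (· * ξ x) h2)

theorem piOp_vec (a g : C_c(G, ℂ)) : piOp μ a (vec μ g) = vec μ (a * g) := by
  apply Lp.ext
  filter_upwards [coeFn_piOp μ a (vec μ g), coeFn_vec μ g, coeFn_vec μ (a * g)] with x h1 h2 h3
  rw [h1, h2, h3]
  rfl

theorem inner_bmul (c : G →ᵇ ℂ) (ξ η : L2 μ) :
    ⟪ξ, bmul μ c η⟫_ℂ = ∫ x, c x * ⟪ξ x, η x⟫_ℂ ∂μ := by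
  rw [L2.inner_def]
  refine integral_congr_ae ?_
  filter_upwards [coeFn_bmul μ c η] with x hx
  rw [hx, RCLike.inner_apply, RCLike.inner_apply]
  ring

theorem inner_vec_bmul_vec (c : G →ᵇ ℂ) (g h : C_c(G, ℂ)) :
    ⟪vec μ g, bmul μ c (vec μ h)⟫_ℂ = ∫ x, star (g x) * (c x * h x) ∂μ := by
  rw [inner_vec_left]
  refine integral_congr_ae ?_
  filter_upwards [coeFn_bmul μ c (vec μ h), coeFn_vec μ h] with x h1 h2
  rw [h1, h2]

/-- The compactly supported product of a compactly supported function and a bounded one. -/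
def mulCc (a : C_c(G, ℂ)) (c : G →ᵇ ℂ) : C_c(G, ℂ) where
  toFun x := a x * c x
  continuous_toFun := a.continuous.mul c.continuous
  hasCompactSupport' := a.hasCompactSupport.mul_right

/-- A compactly supported continuous function as a bounded continuous function. -/
def toBCF (a : C_c(G, ℂ)) : G →ᵇ ℂ :=
  .ofNormedAddCommGroup a a.continuous _ (a.hasCompactSupport.exists_bound_of_continuous
    a.continuous).choose_spec

theorem toBCF_apply (a : C_c(G, ℂ)) (x : G) : toBCF a x = a x := rfl

theorem piOp_mulCc (a : C_c(G, ℂ)) (c : G →ᵇ ℂ) : piOp μ (mulCc a c) = piOp μ a * bmul μ c := by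
  ext1 ξ
  apply Lp.ext
  filter_upwards [coeFn_piOp μ (mulCc a c) ξ, coeFn_piOp μ a (bmul μ c ξ), coeFn_bmul μ c ξ]
    with x h1 h2 h3
  rw [h1, mul_apply_eq_comp, h2, h3, ← mul_assoc]
  rfl

theorem piOp_mul (a b : C_c(G, ℂ)) : piOp μ (a * b) = piOp μ a * piOp μ b :=
  piOp_mulCc μ a (toBCF b)

theorem star_piOp (a : C_c(G, ℂ)) : star (piOp μ a) = piOp μ (star a) := by
  refine opext_vec μ fun g k => ?_
  rw [ContinuousLinearMap.star_eq_adjoint, ContinuousLinearMap.adjoint_inner_right, piOp_vec,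
    piOp_vec, inner_vec_vec, inner_vec_vec]
  refine integral_congr_ae (Eventually.of_forall fun x => ?_)
  simp only [CompactlySupportedContinuousMap.mul_apply,
    CompactlySupportedContinuousMap.star_apply, star_mul']
  ring

theorem piOp_add (a b : C_c(G, ℂ)) : piOp μ (a + b) = piOp μ a + piOp μ b :=
  ((ContinuousLinearMap.lsmul ℂ ℂ).holderL μ ∞ 2 2).map_add
    ((a.continuous.memLp_top_of_hasCompactSupport a.hasCompactSupport μ).toLp a)
    ((b.continuous.memLp_top_of_hasCompactSupport b.hasCompactSupport μ).toLp b)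

theorem piOp_smul (c : ℂ) (a : C_c(G, ℂ)) : piOp μ (c • a) = c • piOp μ a :=
  ((ContinuousLinearMap.lsmul ℂ ℂ).holderL μ ∞ 2 2).map_smul c
    ((a.continuous.memLp_top_of_hasCompactSupport a.hasCompactSupport μ).toLp a)

theorem norm_bmul_le (c : G →ᵇ ℂ) : ‖bmul μ c‖ ≤ ‖c‖ := by
  refine ContinuousLinearMap.opNorm_le_bound _ (norm_nonneg _) fun ξ => ?_
  refine Lp.norm_le_mul_norm_of_ae_le_mul ?_
  filter_upwards [coeFn_bmul μ c ξ] with x hx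
  rw [hx, norm_mul]
  exact mul_le_mul_of_nonneg_right (c.norm_coe_le_norm x) (norm_nonneg _)

/-- `bmul` as a continuous linear map. -/
def bmulL : (G →ᵇ ℂ) →L[ℂ] (L2 μ →L[ℂ] L2 μ) :=
  LinearMap.mkContinuous
    { toFun := bmul μ
      map_add' := fun c d =>
        ((ContinuousLinearMap.lsmul ℂ ℂ).holderL μ ∞ 2 2).map_add
          ((memLp_top μ c).toLp c) ((memLp_top μ d).toLp d)
      map_smul' := fun r c =>
        ((ContinuousLinearMap.lsmul ℂ ℂ).holderL μ ∞ 2 2).map_smul r ((memLp_top μ c).toLp c) }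
    1 fun c => (norm_bmul_le μ c).trans_eq (one_mul _).symm

theorem bmulL_apply (c : G →ᵇ ℂ) : bmulL μ c = bmul μ c := rfl

/-- A function in `C_c(G)` equal to `1` on the support of a given one. -/
theorem exists_mul_eq_self (a : C_c(G, ℂ)) :
    ∃ χ : C_c(G, ℂ), star χ = χ ∧ ∀ x, χ x * a x = a x := by
  obtain ⟨f, hf1, -, hfc, -⟩ := exists_continuous_one_zero_of_isCompact (X := G)
    a.hasCompactSupport.isCompact isClosed_empty (Set.disjoint_empty _)
  refine ⟨⟨⟨fun x => (f x : ℂ), by fun_prop⟩, hfc.comp_left (g := Complex.ofReal) (by simp)⟩, ?_,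
    fun x => ?_⟩
  · ext x
    exact Complex.conj_ofReal _
  · by_cases hx : x ∈ tsupport a
    · have h1 : f x = 1 := hf1 hx
      change (f x : ℂ) * a x = a x
      simp [h1]
    · rw [image_eq_zero_of_notMem_tsupport hx, mul_zero]

open scoped Pointwise in
/-- Uniform continuity of compactly supported continuous functions. -/
theorem exists_nhds_one_norm_sub_lt (a : C_c(G, ℂ)) {ε : ℝ} (hε : 0 < ε) :
    ∃ V ∈ 𝓝 (1 : G), ∀ y ∈ V, ∀ x, ‖a (x * y) - a x‖ < ε := by
  obtain ⟨K, hK, hK1⟩ := exists_compact_mem_nhds (1 : G)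
  -- Uniformity in `x` is needed only on the compact set `tsupport a * K⁻¹`: for other `x`, `a (x *
  -- z) = 0` for all `z ∈ K`, including `z = 1`.
  obtain ⟨v, hv, hvk⟩ := IsCompact.mem_uniformity_of_prod (f := fun y x : G => a (x * y))
    (s := Set.univ) (q := 1) (k := tsupport a * K⁻¹)
    (a.hasCompactSupport.isCompact.mul hK.inv)
    (a.continuous.comp (continuous_snd.mul continuous_fst)).continuousOn (Set.mem_univ _)
    (Metric.dist_mem_uniformity hε)
  rw [nhdsWithin_univ] at hv
  refine ⟨v ∩ K, inter_mem hv hK1, fun y hy x => ?_⟩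
  by_cases hx : x ∈ tsupport a * K⁻¹
  · simpa [dist_eq_norm] using hvk y hy.1 x hx
  · have h0 : ∀ z ∈ K, a (x * z) = 0 := fun z hz => by
      refine image_eq_zero_of_notMem_tsupport fun h => hx ?_
      exact ⟨x * z, h, z⁻¹, Set.inv_mem_inv.2 hz, by simp⟩
    have h1 := h0 1 (mem_of_mem_nhds hK1)
    rw [mul_one] at h1
    rw [h0 y hy.2, h1]
    simpa using hε

end

/-! ### Normal functionals and slices of operators on the tensor product -/

section HilbertTensor

variable {G : Type*} [MeasurableSpace G] {μ : Measure G}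

theorem tmulRight_apply (ξ η : L2 μ) : tmulRight η ξ = tmul ξ η := rfl

theorem norm_tmul (ξ η : L2 μ) : ‖tmul ξ η‖ = ‖ξ‖ * ‖η‖ := by
  rw [← tensorEmb_tmul, LinearIsometry.norm_map, TensorProduct.norm_tmul]

theorem norm_tmulLeft_le (ξ : L2 μ) : ‖tmulLeft ξ‖ ≤ ‖ξ‖ :=
  ContinuousLinearMap.opNorm_le_bound _ (norm_nonneg _) fun η => (norm_tmul ξ η).le

theorem norm_tmulRight_le (η : L2 μ) : ‖tmulRight η‖ ≤ ‖η‖ :=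
  ContinuousLinearMap.opNorm_le_bound _ (norm_nonneg _) fun ξ =>
    ((norm_tmul ξ η).trans (mul_comm _ _)).le

theorem ext_inner_tmul {u v : L2L2 μ} (h : ∀ ξ η, ⟪u, tmul ξ η⟫_ℂ = ⟪v, tmul ξ η⟫_ℂ) : u = v := by
  refine ext_inner_right ℂ fun w => ?_
  refine (denseRange_tensorEmb μ).induction_on (p := fun w => ⟪u, w⟫_ℂ = ⟪v, w⟫_ℂ) w ?_ fun t => ?_
  · exact isClosed_eq (by fun_prop) (by fun_prop)
  · induction t using TensorProduct.induction_on with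
    | zero => simp
    | add s t hs ht => simp only [map_add, inner_add_right, hs, ht]
    | tmul ξ η => exact h ξ η

theorem adjoint_tensorOp_tmul (A B : L2 μ →L[ℂ] L2 μ) (ξ η : L2 μ) :
    (tensorOp A B).adjoint (tmul ξ η) = tmul (A.adjoint ξ) (B.adjoint η) := by
  refine ext_inner_tmul fun ξ' η' => ?_
  rw [ContinuousLinearMap.adjoint_inner_left, tensorOp_tmul, inner_tmul_tmul, inner_tmul_tmul,
    ContinuousLinearMap.adjoint_inner_left, ContinuousLinearMap.adjoint_inner_left]

namespace NormalFunctional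

theorem summable_mul_norm (ω : NormalFunctional μ) : Summable fun n => ‖ω.bra n‖ * ‖ω.ket n‖ := by
  refine Summable.of_nonneg_of_le (fun n => by positivity) (fun n => ?_)
    (ω.summable_bra.add ω.summable_ket)
  nlinarith [two_mul_le_add_sq ‖ω.bra n‖ ‖ω.ket n‖, norm_nonneg (ω.bra n), norm_nonneg (ω.ket n)]

theorem norm_inner_le (ω : NormalFunctional μ) (T : L2 μ →L[ℂ] L2 μ) (n : ℕ) :
    ‖⟪ω.bra n, T (ω.ket n)⟫_ℂ‖ ≤ ‖ω.bra n‖ * ‖ω.ket n‖ * ‖T‖ := by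
  refine (norm_inner_le_norm _ _).trans ?_
  rw [mul_assoc]
  refine mul_le_mul_of_nonneg_left ((T.le_opNorm _).trans_eq (mul_comm _ _)) (norm_nonneg _)

theorem hasSum_eval (ω : NormalFunctional μ) (T : L2 μ →L[ℂ] L2 μ) :
    HasSum (fun n => ⟪ω.bra n, T (ω.ket n)⟫_ℂ) (ω.eval T) :=
  (Summable.of_norm_bounded (ω.summable_mul_norm.mul_right ‖T‖) (ω.norm_inner_le T)).hasSum

theorem eval_sub (ω : NormalFunctional μ) (S T : L2 μ →L[ℂ] L2 μ) :
    ω.eval (S - T) = ω.eval S - ω.eval T := by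
  refine (ω.hasSum_eval (S - T)).unique (((ω.hasSum_eval S).sub (ω.hasSum_eval T)).congr_fun fun n => ?_)
  rw [sub_apply, inner_sub_right]

theorem norm_eval_le (ω : NormalFunctional μ) (T : L2 μ →L[ℂ] L2 μ) :
    ‖ω.eval T‖ ≤ (∑' n, ‖ω.bra n‖ * ‖ω.ket n‖) * ‖T‖ :=
  tsum_of_norm_bounded (ω.summable_mul_norm.hasSum.mul_right ‖T‖) (ω.norm_inner_le T)

/-- Norm continuity is what allows uniform limits of coefficient functions to be taken inside a
normal functional. -/
theorem continuous_eval (ω : NormalFunctional μ) : Continuous ω.eval := by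
  refine LipschitzWith.continuous (K := (∑' n, ‖ω.bra n‖ * ‖ω.ket n‖).toNNReal)
    (LipschitzWith.of_dist_le_mul fun S T => ?_)
  rw [dist_eq_norm, dist_eq_norm, ← eval_sub]
  refine (ω.norm_eval_le _).trans (mul_le_mul_of_nonneg_right (Real.le_coe_toNNReal _)
    (norm_nonneg _))

theorem summable_sliceLeft (ω : NormalFunctional μ) (X : L2L2 μ →L[ℂ] L2L2 μ) :
    Summable fun n => (tmulLeft (ω.bra n)).adjoint ∘L X ∘L tmulLeft (ω.ket n) := by
  refine Summable.of_norm_bounded (ω.summable_mul_norm.mul_right ‖X‖) fun n => ?_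
  refine (ContinuousLinearMap.opNorm_comp_le _ _).trans ?_
  rw [LinearIsometryEquiv.norm_map, mul_assoc]
  refine mul_le_mul (norm_tmulLeft_le _) ((ContinuousLinearMap.opNorm_comp_le _ _).trans ?_)
    (norm_nonneg _) (norm_nonneg _)
  rw [mul_comm]
  exact mul_le_mul_of_nonneg_right (norm_tmulLeft_le _) (norm_nonneg _)

theorem summable_sliceRight (ω : NormalFunctional μ) (X : L2L2 μ →L[ℂ] L2L2 μ) :
    Summable fun n => (tmulRight (ω.bra n)).adjoint ∘L X ∘L tmulRight (ω.ket n) := by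
  refine Summable.of_norm_bounded (ω.summable_mul_norm.mul_right ‖X‖) fun n => ?_
  refine (ContinuousLinearMap.opNorm_comp_le _ _).trans ?_
  rw [LinearIsometryEquiv.norm_map, mul_assoc]
  refine mul_le_mul (norm_tmulRight_le _) ((ContinuousLinearMap.opNorm_comp_le _ _).trans ?_)
    (norm_nonneg _) (norm_nonneg _)
  rw [mul_comm]
  exact mul_le_mul_of_nonneg_right (norm_tmulRight_le _) (norm_nonneg _)

theorem hasSum_inner_sliceLeft (ω : NormalFunctional μ) (X : L2L2 μ →L[ℂ] L2L2 μ) (ξ η : L2 μ) :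
    HasSum (fun n => ⟪tmul (ω.bra n) ξ, X (tmul (ω.ket n) η)⟫_ℂ) ⟪ξ, ω.sliceLeft X η⟫_ℂ := by
  have h := (ω.summable_sliceLeft X).hasSum.mapL
    (innerSL ℂ ξ ∘L ContinuousLinearMap.apply ℂ (L2 μ) η)
  refine h.congr_fun fun n => ?_
  exact ((tmulLeft (ω.bra n)).adjoint_inner_right ξ _).symm

theorem hasSum_inner_sliceRight (θ : NormalFunctional μ) (X : L2L2 μ →L[ℂ] L2L2 μ) (ξ η : L2 μ) :
    HasSum (fun n => ⟪tmul ξ (θ.bra n), X (tmul η (θ.ket n))⟫_ℂ) ⟪ξ, θ.sliceRight X η⟫_ℂ := by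
  have h := (θ.summable_sliceRight X).hasSum.mapL
    (innerSL ℂ ξ ∘L ContinuousLinearMap.apply ℂ (L2 μ) η)
  refine h.congr_fun fun n => ?_
  exact ((tmulRight (θ.bra n)).adjoint_inner_right ξ _).symm

theorem summable_evalTensor (ω θ : NormalFunctional μ) (X : L2L2 μ →L[ℂ] L2L2 μ) :
    Summable fun p : ℕ × ℕ =>
      ⟪tmul (ω.bra p.1) (θ.bra p.2), X (tmul (ω.ket p.1) (θ.ket p.2))⟫_ℂ := by
  refine Summable.of_norm_bounded ((ω.summable_mul_norm.mul_of_nonneg θ.summable_mul_norm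
    (fun n => by positivity) (fun n => by positivity)).mul_right ‖X‖) fun p => ?_
  refine (norm_inner_le_norm _ _).trans ((mul_le_mul_of_nonneg_left (X.le_opNorm _)
    (norm_nonneg _)).trans_eq ?_)
  rw [norm_tmul, norm_tmul]
  ring

/-- Here and in the next lemma, the double series converges absolutely and may be summed in either
order. -/
theorem evalTensor_eq_eval_sliceRight (ω θ : NormalFunctional μ) (X : L2L2 μ →L[ℂ] L2L2 μ) :
    ω.evalTensor θ X = ω.eval (θ.sliceRight X) := by
  refine (ω.summable_evalTensor θ X).tsum_prod.trans (tsum_congr fun m => ?_)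
  exact (θ.hasSum_inner_sliceRight X (ω.bra m) (ω.ket m)).tsum_eq

theorem evalTensor_eq_eval_sliceLeft (ω θ : NormalFunctional μ) (X : L2L2 μ →L[ℂ] L2L2 μ) :
    ω.evalTensor θ X = θ.eval (ω.sliceLeft X) := by
  refine (ω.summable_evalTensor θ X).tsum_prod.trans
    ((ω.summable_evalTensor θ X).tsum_comm.symm.trans (tsum_congr fun m => ?_))
  exact (ω.hasSum_inner_sliceLeft X (θ.bra m) (θ.ket m)).tsum_eq

/-- The vector functional `⟨· ξ, η⟩`. -/
def single (ξ η : L2 μ) : NormalFunctional μ where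
  ket := Pi.single 0 ξ
  bra := Pi.single 0 η
  summable_ket := summable_of_ne_finset_zero (s := {0}) fun n hn => by
    simp [Pi.single_eq_of_ne (show n ≠ 0 by simpa using hn)]
  summable_bra := summable_of_ne_finset_zero (s := {0}) fun n hn => by
    simp [Pi.single_eq_of_ne (show n ≠ 0 by simpa using hn)]

theorem single_eval (ξ η : L2 μ) (T : L2 μ →L[ℂ] L2 μ) : (single ξ η).eval T = ⟪η, T ξ⟫_ℂ := by
  rw [eval, tsum_eq_single 0]
  · simp [single]
  · intro n hn
    simp [single, Pi.single_eq_of_ne hn]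

theorem inner_single_sliceLeft (ξ η : L2 μ) (X : L2L2 μ →L[ℂ] L2L2 μ) (ξ' η' : L2 μ) :
    ⟪ξ', (single ξ η).sliceLeft X η'⟫_ℂ = ⟪tmul η ξ', X (tmul ξ η')⟫_ℂ := by
  refine ((single ξ η).hasSum_inner_sliceLeft X ξ' η').unique ?_
  refine hasSum_single (f := fun n => ⟪tmul ((single ξ η).bra n) ξ',
    X (tmul ((single ξ η).ket n) η')⟫_ℂ) 0 fun n hn => ?_
  have h0 : (single ξ η).bra n = 0 := by simp [single, Pi.single_eq_of_ne hn]
  rw [h0, ← tmulRight_apply, map_zero, inner_zero_left]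

end NormalFunctional

end HilbertTensor

/-! ### Matrix elements of the multiplicative unitary and of convolution operators -/

section Group

variable {G : Type*} [Group G] [TopologicalSpace G] [IsTopologicalGroup G] [LocallyCompactSpace G]
  [T2Space G] [MeasurableSpace G] [BorelSpace G]
variable (μ : Measure G) [μ.IsHaarMeasure] [μ.Regular]

/-- `W` acts by `λ_x` on the fibre over `x`, so pairing the second legs leaves a coefficient
function multiplying the first leg. Everything later about `W` comes from this identity and the
next. -/
theorem inner_multUnitary_tmul (ξ η ξ' η' : L2 μ) :
    ⟪multUnitary μ (tmul ξ η), tmul ξ' η'⟫_ℂ = ⟪ξ, bmul μ (coef μ η η') ξ'⟫_ℂ := by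
  rw [L2.inner_def, inner_bmul]
  refine integral_congr_ae ?_
  filter_upwards [coeFn_multUnitary μ (tmul ξ η), coeFn_tmul ξ η, coeFn_tmul ξ' η']
    with x h1 h2 h3
  rw [h1, h2, h3, translate_smul, inner_smul_left, inner_smul_right, RCLike.inner_apply, coef_apply]
  ring

theorem inner_tmul_multUnitary (ξ η ξ' η' : L2 μ) :
    ⟪tmul ξ η, multUnitary μ (tmul ξ' η')⟫_ℂ = ⟪ξ, bmul μ (star (coef μ η' η)) ξ'⟫_ℂ := by
  rw [L2.inner_def, inner_bmul]
  refine integral_congr_ae ?_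
  filter_upwards [coeFn_multUnitary μ (tmul ξ' η'), coeFn_tmul ξ η, coeFn_tmul ξ' η']
    with x h1 h2 h3
  rw [h1, h2, h3, translate_smul, inner_smul_left, inner_smul_right, RCLike.inner_apply,
    star_coef_apply]
  ring

theorem inner_convOp (b : C_c(G, ℂ)) (ξ η : L2 μ) :
    ⟪ξ, convOp μ b η⟫_ℂ = ∫ z, b z * ⟪ξ, translate μ z η⟫_ℂ ∂μ := by
  change ⟪ξ, ∫ z, b z • translate μ z η ∂μ⟫_ℂ = _
  rw [← integral_inner (integrable_smul_translate μ b η)]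
  simp only [inner_smul_right]

theorem inner_convOp_left (b : C_c(G, ℂ)) (ξ η : L2 μ) :
    ⟪convOp μ b ξ, η⟫_ℂ = ∫ z, star (b z) * coef μ ξ η z ∂μ := by
  rw [← inner_conj_symm, inner_convOp, ← integral_conj]
  simp only [map_mul, inner_conj_symm, coef_apply]
  rfl

theorem convOp_add (b c : C_c(G, ℂ)) : convOp μ (b + c) = convOp μ b + convOp μ c := by
  ext1 ξ
  change ∫ z, (b z + c z) • translate μ z ξ ∂μ =
    ∫ z, b z • translate μ z ξ ∂μ + ∫ z, c z • translate μ z ξ ∂μ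
  simp only [add_smul]
  exact integral_add (integrable_smul_translate μ b ξ) (integrable_smul_translate μ c ξ)

theorem convOp_smul (r : ℂ) (b : C_c(G, ℂ)) : convOp μ (r • b) = r • convOp μ b := by
  ext1 ξ
  change ∫ z, (r • b z) • translate μ z ξ ∂μ = r • ∫ z, b z • translate μ z ξ ∂μ
  simp only [smul_assoc]
  exact integral_smul _ _

end Group

/-! ### Convolution on `C_c(G)` and symmetric approximate units -/

section

variable {G : Type*} [Group G] [TopologicalSpace G] [IsTopologicalGroup G] [LocallyCompactSpace G]
  [T2Space G] [MeasurableSpace G] [BorelSpace G]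
variable (μ : Measure G) [μ.IsHaarMeasure] [μ.Regular]

theorem integrable_Cc (a : C_c(G, ℂ)) : Integrable a μ :=
  a.continuous.integrable_of_hasCompactSupport a.hasCompactSupport

/-- The functional `c ↦ ∫ a c` on bounded continuous functions. -/
def integralMulL (a : C_c(G, ℂ)) : (G →ᵇ ℂ) →L[ℂ] ℂ :=
  -- With a real cutoff `χ` such that `χ a = a`, the integral is the matrix element `⟨χ, c a⟩`,
  -- which is visibly continuous in `c`.
  innerSL ℂ (vec μ (exists_mul_eq_self a).choose) ∘L
    ContinuousLinearMap.apply ℂ (L2 μ) (vec μ a) ∘L bmulL μ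

theorem integralMulL_apply (a : C_c(G, ℂ)) (c : G →ᵇ ℂ) :
    integralMulL μ a c = ∫ x, a x * c x ∂μ := by
  obtain ⟨h1, h2⟩ := (exists_mul_eq_self a).choose_spec
  refine (inner_vec_bmul_vec μ c _ a).trans (integral_congr_ae (Eventually.of_forall fun x => ?_))
  have h3 := DFunLike.congr_fun h1 x
  rw [CompactlySupportedContinuousMap.star_apply] at h3
  simp only [h3]
  rw [mul_left_comm, h2, mul_comm]

/-- Haar measure need not be σ-finite, so integrals are interchanged for continuous kernels of
compact support. -/
theorem integral_integral_swap_of_eq_zero {F : G → G → ℂ} (hF : Continuous F.uncurry)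
    {K L : Set G} (hK : IsCompact K) (hL : IsCompact L) (h : ∀ x y, x ∉ K ∨ y ∉ L → F x y = 0) :
    ∫ x, ∫ y, F x y ∂μ ∂μ = ∫ y, ∫ x, F x y ∂μ ∂μ := by
  refine integral_integral_swap_of_hasCompactSupport hF
    (HasCompactSupport.intro (hK.prod hL) fun p hp => ?_)
  refine h p.1 p.2 ?_
  rw [Set.mem_prod, not_and_or] at hp
  exact hp

open scoped Pointwise in
theorem mul_translate_eq_zero (b g : C_c(G, ℂ)) (z x : G)
    (h : z ∉ tsupport b ∨ x ∉ tsupport b * tsupport g) : b z * g (z⁻¹ * x) = 0 := by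
  by_cases hz : z ∈ tsupport b
  · rw [image_eq_zero_of_notMem_tsupport (f := g), mul_zero]
    intro hg
    exact h.elim (fun h => h hz) fun h => h ⟨z, hz, z⁻¹ * x, hg, by simp⟩
  · rw [image_eq_zero_of_notMem_tsupport hz, zero_mul]

/-- The convolution of two compactly supported continuous functions. -/
def convCc (b g : C_c(G, ℂ)) : C_c(G, ℂ) where
  toFun x := ∫ z, b z * g (z⁻¹ * x) ∂μ
  continuous_toFun := by
    rw [← continuousOn_univ]
    refine continuousOn_integral_of_compact_support (f := fun x z => b z * g (z⁻¹ * x))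
      b.hasCompactSupport.isCompact ?_ fun p x _ hx => mul_translate_eq_zero b g x p (.inl hx)
    exact ((b.continuous.comp continuous_snd).mul
      (g.continuous.comp (continuous_snd.inv.mul continuous_fst))).continuousOn
  hasCompactSupport' := by
    refine HasCompactSupport.intro
      (b.hasCompactSupport.isCompact.mul g.hasCompactSupport.isCompact) fun x hx => ?_
    simp only [mul_translate_eq_zero b g _ x (.inr hx), integral_zero]

theorem convCc_apply (b g : C_c(G, ℂ)) (x : G) :
    convCc μ b g x = ∫ z, b z * g (z⁻¹ * x) ∂μ := rfl

theorem convOp_vec (b g : C_c(G, ℂ)) : convOp μ b (vec μ g) = vec μ (convCc μ b g) := by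
  refine ext_inner_vec μ fun h => ?_
  rw [inner_convOp, inner_vec_vec]
  simp only [translate_vec, inner_vec_vec, convCc_apply, ← integral_const_mul, translateCc_apply]
  rw [integral_integral_swap_of_eq_zero μ _ b.hasCompactSupport.isCompact
    h.hasCompactSupport.isCompact]
  · refine integral_congr_ae (Eventually.of_forall fun x => integral_congr_ae
      (Eventually.of_forall fun z => ?_))
    ring
  · rintro z x (hz | hx)
    · rw [image_eq_zero_of_notMem_tsupport hz, zero_mul]
    · rw [image_eq_zero_of_notMem_tsupport hx, star_zero, zero_mul, mul_zero]
  · exact (b.continuous.comp continuous_fst).mul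
      ((h.continuous.comp continuous_snd).star.mul
        (g.continuous.comp (continuous_fst.inv.mul continuous_snd)))

theorem integral_convCc (b g : C_c(G, ℂ)) :
    ∫ x, convCc μ b g x ∂μ = (∫ x, b x ∂μ) * ∫ x, g x ∂μ := by
  simp only [convCc_apply]
  rw [integral_integral_swap_of_eq_zero μ _
    (b.hasCompactSupport.isCompact.mul g.hasCompactSupport.isCompact)
    b.hasCompactSupport.isCompact fun x z h => mul_translate_eq_zero b g z x h.symm]
  · simp only [integral_const_mul, integral_mul_left_eq_self (fun x => g x), integral_mul_const]
  · exact (b.continuous.comp continuous_snd).mul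
      (g.continuous.comp (continuous_snd.inv.mul continuous_fst))

/-- The function `e` is nonnegative, symmetric, supported in `U` and has integral `1`. -/
structure IsBump (U : Set G) (e : C_c(G, ℂ)) : Prop where
  eq_norm : ∀ x, e x = (‖e x‖ : ℂ)
  symm : ∀ x, e x⁻¹ = e x
  eq_zero : ∀ x, x ∉ U → e x = 0
  integral_eq : ∫ x, e x ∂μ = 1

/-- The product `f x * f x⁻¹` is symmetric and still `1` at the unit, so it can be normalised.
Symmetry makes `e (z⁻¹ * x)` have integral one in `z` as well as in `x`, with no modular function
appearing. -/
theorem exists_isBump {U : Set G} (hU : U ∈ 𝓝 1) : ∃ e, IsBump μ U e := by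
  obtain ⟨V, hVU, hV, hV1⟩ := mem_nhds_iff.1 (inter_mem hU (inv_mem_nhds_one G hU))
  obtain ⟨f, hf1, hfc, hfV, hf⟩ := exists_continuousMap_one_of_isCompact_subset_isOpen
    (isCompact_singleton (x := (1 : G))) hV (by simpa using hV1)
  have hf1 : f 1 = 1 := hf1 rfl
  let g : G → ℝ := fun x => f x * f x⁻¹
  have hg : Continuous g := by fun_prop
  have hg0 : 0 ≤ g := fun x => mul_nonneg (hf x).1 (hf _).1
  have hgc : HasCompactSupport g := HasCompactSupport.mul_right (f := f) hfc
  have hpos : 0 < ∫ x, g x ∂μ := hg.integral_pos_of_hasCompactSupport_nonneg_nonzero hgc hg0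
    (x := 1) (by simp [g, hf1])
  have hc : Continuous fun x => ((g x / ∫ x, g x ∂μ : ℝ) : ℂ) := by fun_prop
  refine ⟨⟨⟨_, hc⟩, ?_⟩, fun x => ?_, fun x => ?_, fun x hx => ?_, ?_⟩
  · exact hgc.comp_left (g := fun t : ℝ => ((t / ∫ x, g x ∂μ : ℝ) : ℂ)) (by simp)
  · change ((g x / ∫ x, g x ∂μ : ℝ) : ℂ) = (‖((g x / ∫ x, g x ∂μ : ℝ) : ℂ)‖ : ℂ)
    rw [Complex.norm_real, Real.norm_of_nonneg (div_nonneg (hg0 x) hpos.le)]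
  · change ((g x⁻¹ / ∫ x, g x ∂μ : ℝ) : ℂ) = ((g x / ∫ x, g x ∂μ : ℝ) : ℂ)
    simp only [g, inv_inv, mul_comm]
  · change ((g x / ∫ x, g x ∂μ : ℝ) : ℂ) = 0
    have : f x = 0 := image_eq_zero_of_notMem_tsupport fun h => hx (hVU (hfV h)).1
    simp [g, this]
  · change ∫ x, ((g x / ∫ x, g x ∂μ : ℝ) : ℂ) ∂μ = 1
    rw [integral_complex_ofReal, integral_div, div_self hpos.ne', Complex.ofReal_one]

/-- The filter of symmetric bump functions whose supports shrink to the unit. -/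
def bumps : Filter C_c(G, ℂ) := (𝓝 (1 : G)).lift' fun U => {e | IsBump μ U e}

theorem eventually_bumps {U : Set G} (hU : U ∈ 𝓝 1) : ∀ᶠ e in bumps μ, IsBump μ U e :=
  mem_lift' hU

instance neBot_bumps : (bumps μ).NeBot := by
  refine (lift'_neBot_iff ?_).2 fun U hU => exists_isBump μ hU
  exact fun U V hUV e he => ⟨he.eq_norm, he.symm, fun x hx => he.eq_zero x fun h => hx (hUV h),
    he.integral_eq⟩

variable {μ}

theorem IsBump.star_eq {U : Set G} {e : C_c(G, ℂ)} (he : IsBump μ U e) (x : G) :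
    star (e x) = e x := by
  rw [he.eq_norm]
  exact Complex.conj_ofReal _

theorem IsBump.integral_norm {U : Set G} {e : C_c(G, ℂ)} (he : IsBump μ U e) :
    ∫ x, ‖e x‖ ∂μ = 1 := by
  have h := he.integral_eq
  rw [integral_congr_ae (Eventually.of_forall he.eq_norm), integral_complex_ofReal] at h
  exact_mod_cast h

theorem IsBump.apply_inv_mul {U : Set G} {e : C_c(G, ℂ)} (he : IsBump μ U e) (x z : G) :
    e (z⁻¹ * x) = e (x⁻¹ * z) := by
  rw [← he.symm]
  simp

theorem IsBump.coef_vec {U : Set G} {e : C_c(G, ℂ)} (he : IsBump μ U e) (a : C_c(G, ℂ)) (x : G) :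
    coef μ (vec μ e) (vec μ a) x = ∫ y, e y * a (x * y) ∂μ := by
  rw [coef_apply, translate_vec, inner_vec_vec,
    ← integral_mul_left_eq_self (fun y => e y * a (x * y)) x⁻¹]
  refine integral_congr_ae (Eventually.of_forall fun y => ?_)
  simp only [translateCc_apply, he.star_eq, mul_inv_cancel_left]

/-- Symmetry of `e` identifies `b * e` with the coefficient of `e` against `b`. The same function is
thus open to both sup norm and `L²` estimates. -/
theorem IsBump.toBCF_convCc {U : Set G} {e : C_c(G, ℂ)} (he : IsBump μ U e) (b : C_c(G, ℂ)) :
    toBCF (convCc μ b e) = coef μ (vec μ e) (vec μ b) := by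
  ext x
  rw [toBCF_apply, convCc_apply, coef_apply, translate_vec, inner_vec_vec]
  refine integral_congr_ae (Eventually.of_forall fun y => ?_)
  simp only [translateCc_apply, he.star_eq, he.apply_inv_mul x y, mul_comm]

theorem IsBump.norm_integral_mul_le {U : Set G} {e : C_c(G, ℂ)} (he : IsBump μ U e) {f : G → ℂ}
    {C : ℝ} (hf : ∀ y ∈ U, ‖f y‖ ≤ C) : ‖∫ y, e y * f y ∂μ‖ ≤ C := by
  refine (norm_integral_le_of_norm_le ((integrable_Cc μ e).norm.mul_const C)
    (Eventually.of_forall fun y => ?_)).trans_eq ?_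
  · rw [norm_mul]
    by_cases hy : y ∈ U
    · exact mul_le_mul_of_nonneg_left (hf y hy) (norm_nonneg _)
    · simp [he.eq_zero y hy]
  · rw [integral_mul_const, he.integral_norm, one_mul]

theorem IsBump.norm_coef_vec_le {U : Set G} {e : C_c(G, ℂ)} (he : IsBump μ U e) (a : C_c(G, ℂ)) :
    ‖coef μ (vec μ e) (vec μ a)‖ ≤ ‖toBCF a‖ := by
  refine (BoundedContinuousFunction.norm_le (norm_nonneg _)).2 fun x => ?_
  rw [he.coef_vec]
  exact he.norm_integral_mul_le fun y _ => (toBCF a).norm_coe_le_norm _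

variable (μ)

/-- The coefficient at `x` is the average of `y ↦ a (x * y)` with weight `e`, so uniform continuity
of `a` applies. -/
theorem tendsto_coef_vec (a : C_c(G, ℂ)) :
    Tendsto (fun e => coef μ (vec μ e) (vec μ a)) (bumps μ) (𝓝 (toBCF a)) := by
  rw [Metric.tendsto_nhds]
  intro ε hε
  obtain ⟨V, hV, hVa⟩ := exists_nhds_one_norm_sub_lt a (half_pos hε)
  filter_upwards [eventually_bumps μ hV] with e he
  refine lt_of_le_of_lt ((BoundedContinuousFunction.dist_le (half_pos hε).le).2 fun x => ?_)
    (half_lt_self hε)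
  have h1 : Integrable (fun y => e y * a (x * y)) μ :=
    (e.continuous.mul (a.continuous.comp (continuous_const.mul continuous_id)))
      |>.integrable_of_hasCompactSupport e.hasCompactSupport.mul_right
  have h2 : coef μ (vec μ e) (vec μ a) x - a x = ∫ y, e y * (a (x * y) - a x) ∂μ := by
    simp only [mul_sub]
    rw [integral_sub h1 ((integrable_Cc μ e).mul_const _), integral_mul_const, he.integral_eq,
      one_mul, he.coef_vec]
  rw [dist_eq_norm, toBCF_apply, h2]
  exact he.norm_integral_mul_le fun y hy => (hVa y hy x).le

theorem toBCF_sub (a b : C_c(G, ℂ)) : toBCF (a - b) = toBCF a - toBCF b := rfl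

theorem coef_sub_right (ξ η η' : L2 μ) : coef μ ξ (η - η') = coef μ ξ η - coef μ ξ η' := by
  ext x
  exact inner_sub_right (𝕜 := ℂ) (translate μ x ξ) η η'

theorem tendsto_coef_convOp (b : C_c(G, ℂ)) :
    Tendsto (fun e => coef μ (vec μ e) (convOp μ b (vec μ e))) (bumps μ) (𝓝 (toBCF b)) := by
  rw [tendsto_iff_norm_sub_tendsto_zero]
  -- One copy of `‖b * e - b‖` pays for replacing `L_b e = b * e` by `b`, since pairing with `e`
  -- contracts the sup norm. The other is the remaining distance to `b`.
  have h := (tendsto_iff_norm_sub_tendsto_zero.1 (tendsto_coef_vec μ b)).const_mul 2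
  rw [mul_zero] at h
  refine squeeze_zero' (Eventually.of_forall fun e => norm_nonneg _) ?_ h
  filter_upwards [eventually_bumps μ univ_mem] with e he
  have h1 := he.norm_coef_vec_le (convCc μ b e - b)
  rw [toBCF_sub, he.toBCF_convCc, vec_sub, coef_sub_right] at h1
  rw [convOp_vec, two_mul]
  refine (norm_sub_le_norm_sub_add_norm_sub _ (coef μ (vec μ e) (vec μ b)) _).trans ?_
  gcongr

theorem norm_vec_sq (g : C_c(G, ℂ)) : ‖vec μ g‖ ^ 2 = (∫ x, (star g * g) x ∂μ).re := by
  rw [← inner_self_eq_norm_sq (𝕜 := ℂ), inner_vec_vec]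
  rfl

variable {μ}

/-- Jensen's inequality `|g * e|² ≤ |g|² * e`: the weight `e (z⁻¹ * x) dz` has total mass one, and
the difference of the two sides is the variance of `g` under it. -/
theorem IsBump.sq_convCc_le {U : Set G} {e : C_c(G, ℂ)} (he : IsBump μ U e) (g : C_c(G, ℂ)) (x : G) :
    ((star (convCc μ g e) * convCc μ g e) x).re ≤ (convCc μ (star g * g) e x).re := by
  have hi : ∀ h : G → ℂ, Continuous h → Integrable (fun z => h z * e (z⁻¹ * x)) μ := fun h hh => by
    simp only [he.apply_inv_mul x]
    exact (hh.mul (translateCc x e).continuous).integrable_of_hasCompactSupport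
      (translateCc x e).hasCompactSupport.mul_left
  have h1 : ∫ z, e (z⁻¹ * x) ∂μ = 1 := by
    simp only [he.apply_inv_mul x]
    rw [integral_mul_left_eq_self (fun x => e x), he.integral_eq]
  set c := convCc μ g e x with hc
  have h2 : convCc μ (star g * g) e x - star c * c =
      ∫ z, (star (g z - c) * (g z - c)) * e (z⁻¹ * x) ∂μ := by
    have e1 : ∀ z, (star (g z - c) * (g z - c)) * e (z⁻¹ * x) =
        (star g * g) z * e (z⁻¹ * x) - star c * (g z * e (z⁻¹ * x))
          - c * (star (g z * e (z⁻¹ * x))) + star c * c * e (z⁻¹ * x) := fun z => by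
      simp only [star_sub, star_mul', he.star_eq, CompactlySupportedContinuousMap.mul_apply,
        CompactlySupportedContinuousMap.star_apply]
      ring
    have i1 : Integrable (fun z => (star g * g) z * e (z⁻¹ * x)) μ := hi _ (star g * g).continuous
    have i2 : Integrable (fun z => g z * e (z⁻¹ * x)) μ := hi _ g.continuous
    have i3 : Integrable (fun z => star (g z * e (z⁻¹ * x))) μ := by
      have := hi _ (star g).continuous
      refine this.congr (Eventually.of_forall fun z => ?_)
      simp only [star_mul', he.star_eq]
      rfl
    have i4 : Integrable (fun z => e (z⁻¹ * x)) μ := by simpa using hi 1 continuous_one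
    have h3 : ∫ z, star (g z * e (z⁻¹ * x)) ∂μ = star c := integral_conj
    have i5 : Integrable (fun z => (star g * g) z * e (z⁻¹ * x)
        - star c * (g z * e (z⁻¹ * x))) μ := i1.sub (i2.const_mul _)
    have i6 : Integrable (fun z => (star g * g) z * e (z⁻¹ * x)
        - star c * (g z * e (z⁻¹ * x)) - c * (star (g z * e (z⁻¹ * x)))) μ :=
      i5.sub (i3.const_mul _)
    simp only [e1]
    rw [integral_add i6 (i4.const_mul _), integral_sub i5 (i3.const_mul _),
      integral_sub i1 (i2.const_mul _),
      integral_const_mul, integral_const_mul, integral_const_mul, h1, h3]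
    rw [show ∫ z, g z * e (z⁻¹ * x) ∂μ = c from rfl]
    rw [show ∫ z, (star g * g) z * e (z⁻¹ * x) ∂μ = convCc μ (star g * g) e x from rfl]
    ring
  have h4 : 0 ≤ (convCc μ (star g * g) e x - star c * c).re := by
    rw [h2, ← RCLike.re_eq_complex_re, ← integral_re]
    · refine integral_nonneg fun z => ?_
      rw [he.eq_norm]
      have : star (g z - c) * (g z - c) = ((‖g z - c‖ ^ 2 : ℝ) : ℂ) := by
        push_cast
        exact Complex.conj_mul' _
      rw [this, ← Complex.ofReal_mul]
      exact mul_nonneg (by positivity) (norm_nonneg _)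
    · exact hi _ (by fun_prop)
  rw [Complex.sub_re, sub_nonneg] at h4
  exact h4

/-- Integrate the pointwise Jensen inequality; convolution with `e` preserves the integral of
`|g|²`. -/
theorem IsBump.norm_convOp_vec_le {U : Set G} {e : C_c(G, ℂ)} (he : IsBump μ U e)
    (g : C_c(G, ℂ)) : ‖convOp μ g (vec μ e)‖ ≤ ‖vec μ g‖ := by
  rw [convOp_vec]
  refine le_of_sq_le_sq ?_ (norm_nonneg _)
  have h : ∫ x, (star g * g) x ∂μ = ∫ x, convCc μ (star g * g) e x ∂μ := by
    rw [integral_convCc, he.integral_eq, mul_one]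
  rw [norm_vec_sq, norm_vec_sq, h]
  simp only [← RCLike.re_eq_complex_re]
  rw [← integral_re (integrable_Cc μ _), ← integral_re (integrable_Cc μ _)]
  exact integral_mono (integrable_Cc μ _).re (integrable_Cc μ _).re (he.sq_convCc_le g)

/-- Expanding the square gives `‖u - v‖² ≤ 2 ‖v‖² - 2 Re ⟨v, u⟩`, which tends to zero. -/
theorem tendsto_of_norm_le_of_tendsto_inner {ι : Type*} {l : Filter ι} {u : ι → L2 μ} {v : L2 μ}
    (hu : ∀ᶠ i in l, ‖u i‖ ≤ ‖v‖) (h : Tendsto (fun i => ⟪v, u i⟫_ℂ) l (𝓝 ⟪v, v⟫_ℂ)) :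
    Tendsto u l (𝓝 v) := by
  rw [tendsto_iff_norm_sub_tendsto_zero]
  have h1 : Tendsto (fun i => √(2 * ‖v‖ ^ 2 - 2 * (⟪v, u i⟫_ℂ).re)) l (𝓝 0) := by
    have := ((Complex.continuous_re.tendsto _).comp h).const_mul 2 |>.const_sub (2 * ‖v‖ ^ 2)
    have h0 : (⟪v, v⟫_ℂ).re = ‖v‖ ^ 2 := inner_self_eq_norm_sq (𝕜 := ℂ) v
    rw [h0, sub_self] at this
    simpa [Function.comp_def] using (Real.continuous_sqrt.tendsto _).comp this
  refine squeeze_zero' (Eventually.of_forall fun e => norm_nonneg _) ?_ h1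
  filter_upwards [hu] with i hi
  refine Real.le_sqrt_of_sq_le ?_
  rw [← norm_neg, neg_sub, norm_sub_sq (𝕜 := ℂ)]
  have : ‖u i‖ ^ 2 ≤ ‖v‖ ^ 2 := by gcongr
  simp only [RCLike.re_eq_complex_re]
  linarith

variable (μ)

theorem tendsto_convOp_vec (b : C_c(G, ℂ)) :
    Tendsto (fun e => convOp μ b (vec μ e)) (bumps μ) (𝓝 (vec μ b)) := by
  refine tendsto_of_norm_le_of_tendsto_inner ?_ ?_
  · filter_upwards [eventually_bumps μ univ_mem] with e he using he.norm_convOp_vec_le b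
  · have h := ((integralMulL μ (star b)).continuous.tendsto _).comp (tendsto_coef_vec μ b)
    have h0 : integralMulL μ (star b) (toBCF b) = ⟪vec μ b, vec μ b⟫_ℂ := by
      rw [integralMulL_apply, inner_vec_vec]
      rfl
    rw [h0] at h
    refine h.congr' ?_
    filter_upwards [eventually_bumps μ univ_mem] with e he
    rw [Function.comp_apply, integralMulL_apply, convOp_vec, inner_vec_vec, ← he.toBCF_convCc]
    rfl

/-- Moving the symmetric `e` across the inner product gives `⟨g, T e⟩ = ⟨g * e, ξ⟩`. The contraction
`g ↦ g * e` then yields `‖T e‖ ≤ ‖ξ‖`, while `g * e → g` yields weak convergence against `C_c(G)`.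
Together they force norm convergence. In particular `T` determines `ξ`. -/
theorem tendsto_of_isConvolutionBy {T : L2 μ →L[ℂ] L2 μ} {ξ : L2 μ} (hT : IsConvolutionBy μ T ξ) :
    Tendsto (fun e => T (vec μ e)) (bumps μ) (𝓝 ξ) := by
  have key : ∀ᶠ e in bumps μ, ∀ g, ⟪vec μ g, T (vec μ e)⟫_ℂ = ⟪convOp μ g (vec μ e), ξ⟫_ℂ := by
    filter_upwards [eventually_bumps μ univ_mem] with e he g
    rw [inner_vec_left, inner_convOp_left]
    refine integral_congr_ae ?_
    filter_upwards [hT e] with x hx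
    rw [show T (vec μ e) x = _ from hx, coef_apply, translate_vec, inner_vec_left]
    congr 1
    refine integral_congr_ae (Eventually.of_forall fun y => ?_)
    simp only [translateCc_apply, he.star_eq, he.apply_inv_mul x y, mul_comm]
  have hle : ∀ᶠ e in bumps μ, ‖T (vec μ e)‖ ≤ ‖ξ‖ := by
    filter_upwards [key, eventually_bumps μ univ_mem] with e hk he
    have h1 : ∀ v, ‖⟪v, T (vec μ e)⟫_ℂ‖ ≤ ‖v‖ * ‖ξ‖ := fun v => by
      refine (denseRange_vec μ).induction_on
        (p := fun v => ‖⟪v, T (vec μ e)⟫_ℂ‖ ≤ ‖v‖ * ‖ξ‖) v ?_ fun g => ?_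
      · exact isClosed_le (by fun_prop) (by fun_prop)
      · rw [hk]
        exact (norm_inner_le_norm _ _).trans
          (mul_le_mul_of_nonneg_right (he.norm_convOp_vec_le g) (norm_nonneg _))
    have h2 := h1 (T (vec μ e))
    rw [inner_self_eq_norm_sq_to_K, norm_pow, RCLike.norm_ofReal, abs_norm, sq] at h2
    rcases (norm_nonneg (T (vec μ e))).eq_or_lt with h0 | h0
    · rw [← h0]
      exact norm_nonneg _
    · exact le_of_mul_le_mul_left h2 h0
  refine tendsto_of_norm_le_of_tendsto_inner hle ?_
  have hw : ∀ g, Tendsto (fun e => ⟪vec μ g, T (vec μ e)⟫_ℂ) (bumps μ) (𝓝 ⟪vec μ g, ξ⟫_ℂ) := by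
    intro g
    refine (((tendsto_convOp_vec μ g).inner tendsto_const_nhds)).congr' ?_
    filter_upwards [key] with e hk using (hk g).symm
  rw [Metric.tendsto_nhds]
  intro ε hε
  obtain ⟨g, hg⟩ := (Metric.mem_closure_range_iff.1 (denseRange_vec μ ξ))
    -- Replacing `ξ` by `g` on the left costs at most `ε / 3` against each of `T e` and `ξ`; the `+
    -- 1` covers `ξ = 0`.
    (ε / (3 * (‖ξ‖ + 1))) (by positivity)
  filter_upwards [hle, Metric.tendsto_nhds.1 (hw g) (ε / 3) (by positivity)] with e h1 h2
  have h3 : ‖ξ - vec μ g‖ * ‖ξ‖ ≤ ε / 3 := by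
    rw [dist_eq_norm] at hg
    calc ‖ξ - vec μ g‖ * ‖ξ‖ ≤ ε / (3 * (‖ξ‖ + 1)) * (‖ξ‖ + 1) := by gcongr; linarith
      _ = ε / 3 := by field_simp
  have h4 : ⟪ξ, T (vec μ e)⟫_ℂ - ⟪ξ, ξ⟫_ℂ = ⟪ξ - vec μ g, T (vec μ e)⟫_ℂ +
      (⟪vec μ g, T (vec μ e)⟫_ℂ - ⟪vec μ g, ξ⟫_ℂ) - ⟪ξ - vec μ g, ξ⟫_ℂ := by
    simp only [inner_sub_left]
    ring
  rw [dist_eq_norm] at h2 ⊢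
  rw [h4]
  have h5 : ‖⟪ξ - vec μ g, T (vec μ e)⟫_ℂ‖ ≤ ε / 3 := (norm_inner_le_norm _ _).trans
    ((mul_le_mul_of_nonneg_left h1 (norm_nonneg _)).trans h3)
  have h6 : ‖⟪ξ - vec μ g, ξ⟫_ℂ‖ ≤ ε / 3 := (norm_inner_le_norm _ _).trans h3
  refine (norm_sub_le _ _).trans_lt ?_
  have := norm_add_le ⟪ξ - vec μ g, T (vec μ e)⟫_ℂ (⟪vec μ g, T (vec μ e)⟫_ℂ - ⟪vec μ g, ξ⟫_ℂ)
  linarith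

theorem isConvolutionBy_convOp (b : C_c(G, ℂ)) : IsConvolutionBy μ (convOp μ b) (vec μ b) := by
  intro g
  change (convOp μ b (vec μ g) : G → ℂ) =ᵐ[μ] _
  rw [convOp_vec]
  filter_upwards [coeFn_vec μ (convCc μ b g)] with x hx
  rw [hx, convCc_apply]
  refine integral_congr_ae ?_
  filter_upwards [coeFn_vec μ b] with y hy
  rw [hy]

end

/-! ### Linear extension of weights and polarization -/

/-- A linear relation with only `0` over `0` is the graph of a linear map. If it contains the values
of `w` on positive elements of finite weight, that map extends `w` to the whole domain, and
additivity of `w` need not be proved separately. -/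
theorem HasWeight.of_relation {G : Type*} [MeasurableSpace G] {μ : Measure G}
    {N : Set (L2 μ →L[ℂ] L2 μ)} {w : (L2 μ →L[ℂ] L2 μ) → ℝ≥0∞}
    (R : Submodule ℂ ((L2 μ →L[ℂ] L2 μ) × ℂ)) (hR : ∀ v, (0, v) ∈ R → v = 0)
    (hS : ∀ S ∈ N, S.IsPositive → w S < ∞ → (S, ((w S).toReal : ℂ)) ∈ R)
    {T : L2 μ →L[ℂ] L2 μ} {v : ℂ} (hT : T ∈ weightDomain N w) (hv : (T, v) ∈ R) :
    HasWeight N w T v := by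
  have hg : ∀ x : (L2 μ →L[ℂ] L2 μ) × ℂ, x ∈ R → x.1 = 0 → x.2 = 0 := fun x hx hx0 => by
    obtain ⟨x1, x2⟩ := x
    obtain rfl : x1 = 0 := hx0
    exact hR _ hx
  have hle : weightDomain N w ≤ R.map (LinearMap.fst ℂ _ _) :=
    Submodule.span_le.2 fun S h => ⟨_, hS S h.1 h.2.1 h.2.2, rfl⟩
  have huniq : ∀ (S : L2 μ →L[ℂ] L2 μ) (hS : S ∈ weightDomain N w) (u : ℂ), (S, u) ∈ R →
      (R.toLinearPMap.toFun ∘ₗ Submodule.inclusion hle) ⟨S, hS⟩ = u := fun S hS u hu => by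
    have h := R.sub_mem (Submodule.mem_graph_toLinearPMap hg ⟨S, hle hS⟩) hu
    rw [Prod.mk_sub_mk, sub_self] at h
    exact sub_eq_zero.1 (hR _ h)
  exact ⟨hT, R.toLinearPMap.toFun ∘ₗ Submodule.inclusion hle,
    fun S h => huniq S _ _ (hS S h.1 h.2.1 h.2.2), huniq T hT v hv⟩

/-- Polarization: `4 x* y` is a combination of the four squares of `x ± y` and `x ± i y`. -/
theorem star_mul_mem_of_star_mul_self_mem {A : Type*} [Ring A] [StarRing A] [Algebra ℂ A]
    [StarModule ℂ A] {P D : Submodule ℂ A} (h : ∀ x ∈ P, star x * x ∈ D) {x y : A} (hx : x ∈ P)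
    (hy : y ∈ P) : star x * y ∈ D := by
  have h1 := h _ (P.add_mem hx hy)
  have h2 := h _ (P.sub_mem hx hy)
  have h3 := h _ (P.add_mem hx (P.smul_mem Complex.I hy))
  have h4 := h _ (P.sub_mem hx (P.smul_mem Complex.I hy))
  have h5 := D.smul_mem (1 / 4 : ℂ) (D.add_mem (D.sub_mem h1 h2)
    (D.smul_mem Complex.I (D.sub_mem h4 h3)))
  convert h5 using 1
  simp only [star_add, star_sub, star_smul, add_mul, mul_add, sub_mul, mul_sub, smul_mul_assoc,
    mul_smul_comm, Complex.star_def, Complex.conj_I]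
  match_scalars <;> ring_nf <;> simp only [Complex.I_sq] <;> norm_num

/-! ### The Plancherel weight and the Haar weight on products from `C_c(G)` -/

section

variable {G : Type*} [Group G] [TopologicalSpace G] [IsTopologicalGroup G] [LocallyCompactSpace G]
  [T2Space G] [MeasurableSpace G] [BorelSpace G]
variable (μ : Measure G) [μ.IsHaarMeasure] [μ.Regular]

theorem convOp_mem_algMhat (b : C_c(G, ℂ)) : convOp μ b ∈ algMhat μ := by
  rw [algMhat, StarSubalgebra.mem_centralizer_iff]
  intro g hg
  have h : ∀ g ∈ StarSubalgebra.centralizer ℂ (Set.range (convOp μ)),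
      g * convOp μ b = convOp μ b * g := fun g hg =>
    ((StarSubalgebra.mem_centralizer_iff ℂ).1 hg _ ⟨b, rfl⟩).1.symm
  exact ⟨h g hg, h _ (star_mem hg)⟩

theorem tendsto_inner_star_mul_self {S : L2 μ →L[ℂ] L2 μ} {ξ : L2 μ}
    (hS : IsConvolutionBy μ S ξ) :
    Tendsto (fun e => ⟪vec μ e, (star S * S) (vec μ e)⟫_ℂ) (bumps μ) (𝓝 ((‖ξ‖ ^ 2 : ℝ) : ℂ)) := by
  have h := tendsto_of_isConvolutionBy μ hS
  have h1 := h.inner (𝕜 := ℂ) h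
  rw [inner_self_eq_norm_sq_to_K] at h1
  rw [Complex.ofReal_pow]
  refine h1.congr fun e => ?_
  rw [mul_apply_eq_comp, ContinuousLinearMap.star_eq_adjoint,
    ContinuousLinearMap.adjoint_inner_right]

/-- The limit of `⟨e, S* S e⟩` is `‖ξ‖²` and depends only on `S* S`, so all candidates in the
infimum have the same norm. -/
theorem plancherelWeight_eq {S : L2 μ →L[ℂ] L2 μ} {ξ : L2 μ} (hSm : S ∈ algMhat μ)
    (hS : IsConvolutionBy μ S ξ) : plancherelWeight μ (star S * S) = ENNReal.ofReal (‖ξ‖ ^ 2) := by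
  refine le_antisymm (iInf_le_of_le S (iInf₂_le ξ ⟨hSm, rfl, hS⟩))
    (le_iInf fun S' => le_iInf fun ξ' => le_iInf fun h => ?_)
  have h1 := tendsto_inner_star_mul_self μ h.2.2
  rw [h.2.1] at h1
  rw [Complex.ofReal_injective (tendsto_nhds_unique (tendsto_inner_star_mul_self μ hS) h1)]

theorem tendsto_plancherelWeight {T : L2 μ →L[ℂ] L2 μ} (hT : plancherelWeight μ T < ∞) :
    Tendsto (fun e => ⟪vec μ e, T (vec μ e)⟫_ℂ) (bumps μ)
      (𝓝 ((plancherelWeight μ T).toReal : ℂ)) := by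
  simp only [plancherelWeight, iInf_lt_iff] at hT
  obtain ⟨S, ξ, ⟨hSm, rfl, hS⟩, -⟩ := hT
  rw [plancherelWeight_eq μ hSm hS, ENNReal.toReal_ofReal (by positivity)]
  exact tendsto_inner_star_mul_self μ hS

/-- The Plancherel weight is the limit of the vector functionals given by bump functions. -/
theorem hasPhihat_of_tendsto {T : L2 μ →L[ℂ] L2 μ} {v : ℂ}
    (hT : T ∈ weightDomain (algMhat μ) (plancherelWeight μ))
    (hv : Tendsto (fun e => ⟪vec μ e, T (vec μ e)⟫_ℂ) (bumps μ) (𝓝 v)) : HasPhihat μ T v := by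
  -- The relation pairs an operator with its limit along the bumps; it is single-valued because
  -- limits are unique.
  let R : Submodule ℂ ((L2 μ →L[ℂ] L2 μ) × ℂ) :=
    { carrier := {p | Tendsto (fun e => ⟪vec μ e, p.1 (vec μ e)⟫_ℂ) (bumps μ) (𝓝 p.2)}
      add_mem' := fun {p q} hp hq => by
        simpa [inner_add_right] using Tendsto.add hp hq
      zero_mem' := by simp
      smul_mem' := fun c p hp => by
        simpa [inner_smul_right] using Tendsto.const_mul c hp }
  refine HasWeight.of_relation R (fun v hv => ?_) (fun S _ _ h => tendsto_plancherelWeight μ h) hT hv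
  have hv' : Tendsto (fun e => ⟪vec μ e, (0 : L2 μ →L[ℂ] L2 μ) (vec μ e)⟫_ℂ) (bumps μ) (𝓝 v) := hv
  simp only [zero_apply, inner_zero_right] at hv'
  exact tendsto_nhds_unique hv' tendsto_const_nhds

theorem star_convOp_mul_convOp_mem (c b : C_c(G, ℂ)) :
    star (convOp μ c) * convOp μ b ∈ weightDomain (algMhat μ) (plancherelWeight μ) := by
  let P : Submodule ℂ (L2 μ →L[ℂ] L2 μ) := LinearMap.range
    { toFun := convOp μ, map_add' := convOp_add μ, map_smul' := convOp_smul μ : C_c(G, ℂ) →ₗ[ℂ] _ }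
  refine star_mul_mem_of_star_mul_self_mem (P := P) ?_ ⟨c, rfl⟩ ⟨b, rfl⟩
  rintro _ ⟨d, rfl⟩
  refine Submodule.subset_span ⟨mul_mem (star_mem (convOp_mem_algMhat μ d))
    (convOp_mem_algMhat μ d), ContinuousLinearMap.isPositive_adjoint_comp_self _, ?_⟩
  exact (plancherelWeight_eq μ (convOp_mem_algMhat μ d) (isConvolutionBy_convOp μ d)).trans_lt
    ENNReal.ofReal_lt_top

theorem hasPhihat_star_convOp_mul (c b : C_c(G, ℂ)) :
    HasPhihat μ (star (convOp μ c) * convOp μ b) (∫ x, star (c x) * b x ∂μ) := by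
  refine hasPhihat_of_tendsto μ (star_convOp_mul_convOp_mem μ c b) ?_
  rw [← inner_vec_vec]
  refine ((tendsto_convOp_vec μ c).inner (tendsto_convOp_vec μ b)).congr fun e => ?_
  rw [mul_apply_eq_comp, ContinuousLinearMap.star_eq_adjoint,
    ContinuousLinearMap.adjoint_inner_right]

theorem inner_indicator_mulOp {s : Set G} (hs : MeasurableSet s) (hμs : μ s < ∞) (f : Lp ℂ ∞ μ) :
    ⟪indicatorConstLp 2 hs hμs.ne (1 : ℂ), mulOp μ f (indicatorConstLp 2 hs hμs.ne (1 : ℂ))⟫_ℂ =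
      ∫ x in s, f x ∂μ := by
  rw [L2.inner_indicatorConstLp_one]
  refine setIntegral_congr_ae hs ?_
  filter_upwards [coeFn_mulOp μ f (indicatorConstLp 2 hs hμs.ne (1 : ℂ)),
    indicatorConstLp_coeFn (p := 2) (hs := hs) (hμs := hμs.ne) (c := (1 : ℂ))] with x h1 h2 hx
  rw [h1, h2, Set.indicator_of_mem hx, mul_one]

theorem mulOp_add (f g : Lp ℂ ∞ μ) : mulOp μ (f + g) = mulOp μ f + mulOp μ g :=
  ((ContinuousLinearMap.lsmul ℂ ℂ).holderL μ ∞ 2 2).map_add f g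

theorem mulOp_smul (c : ℂ) (f : Lp ℂ ∞ μ) : mulOp μ (c • f) = c • mulOp μ f :=
  ((ContinuousLinearMap.lsmul ℂ ℂ).holderL μ ∞ 2 2).map_smul c f

theorem mulOp_zero : mulOp μ 0 = 0 :=
  ((ContinuousLinearMap.lsmul ℂ ℂ).holderL μ ∞ 2 2).map_zero

/-- In general the operator determines its symbol only locally almost everywhere. Integrable symbols
are determined by their integrals over sets of finite measure, which are matrix elements at
indicator vectors. -/
theorem ae_eq_of_mulOp_eq {f g : Lp ℂ ∞ μ} (hf : Integrable f μ) (hg : Integrable g μ)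
    (h : mulOp μ f = mulOp μ g) : f =ᵐ[μ] g := by
  refine hf.ae_eq_of_forall_setIntegral_eq _ _ hg fun s hs hμs => ?_
  rw [← inner_indicator_mulOp μ hs hμs, h, inner_indicator_mulOp μ hs hμs]

open scoped ComplexOrder in
-- Positivity at indicator vectors makes the integral of `f` over every set of finite measure
-- nonnegative, so `f = ‖f‖` almost everywhere.
theorem integral_eq_of_isPositive {f : Lp ℂ ∞ μ} (hf : Integrable f μ)
    (hp : (mulOp μ f).IsPositive) : ∫ x, f x ∂μ = ((∫⁻ x, ‖f x‖ₑ ∂μ).toReal : ℂ) := by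
  have hpos : ∀ s, MeasurableSet s → μ s < ∞ → 0 ≤ ∫ x in s, f x ∂μ := fun s hs hμs => by
    rw [← inner_indicator_mulOp μ hs hμs]
    exact hp.inner_nonneg_right _
  have him : ∀ᵐ x ∂μ, (f x).im = 0 := by
    refine hf.im.ae_eq_zero_of_forall_setIntegral_eq_zero fun s hs hμs => ?_
    exact (integral_im hf.restrict).trans (Complex.nonneg_iff.1 (hpos s hs hμs)).2.symm
  have hre : ∀ᵐ x ∂μ, 0 ≤ (f x).re := by
    refine ae_nonneg_of_forall_setIntegral_nonneg hf.re fun s hs hμs => ?_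
    exact (Complex.nonneg_iff.1 (hpos s hs hμs)).1.trans_eq (integral_re hf.restrict).symm
  have h : ∀ᵐ x ∂μ, f x = (‖f x‖ : ℂ) := by
    filter_upwards [him, hre] with x h1 h2
    have : f x = ((f x).re : ℂ) := Complex.ext rfl h1
    rw [this, Complex.norm_real, Real.norm_of_nonneg h2]
  rw [integral_congr_ae h, integral_complex_ofReal, integral_norm_eq_lintegral_enorm hf.1]

theorem haarWeight_le (f : Lp ℂ ∞ μ) : haarWeight μ (mulOp μ f) ≤ ∫⁻ x, ‖f x‖ₑ ∂μ :=
  iInf₂_le (f := fun (g : Lp ℂ ∞ μ) (_ : mulOp μ g = mulOp μ f) => ∫⁻ x, ‖g x‖ₑ ∂μ) f rfl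

/-- A competing symbol either has infinite integral or is integrable and hence agrees with `f`
almost everywhere. -/
theorem haarWeight_eq {f : Lp ℂ ∞ μ} (hf : Integrable f μ) :
    haarWeight μ (mulOp μ f) = ∫⁻ x, ‖f x‖ₑ ∂μ := by
  refine le_antisymm (haarWeight_le μ f) (le_iInf₂ fun g hg => ?_)
  by_cases h : ∫⁻ x, ‖g x‖ₑ ∂μ < ∞
  · have hgi : Integrable g μ := ⟨Lp.aestronglyMeasurable g, h⟩
    refine (lintegral_congr_ae ?_).le
    filter_upwards [ae_eq_of_mulOp_eq μ hf hgi hg.symm] with x hx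
    rw [hx]
  · rw [not_lt_top_iff.1 h]
    exact le_top

theorem hasPhi_of_integrable {f : Lp ℂ ∞ μ} (hf : Integrable f μ)
    (hT : mulOp μ f ∈ weightDomain (algM μ) (haarWeight μ)) :
    HasPhi μ (mulOp μ f) (∫ x, f x ∂μ) := by
  let R : Submodule ℂ ((L2 μ →L[ℂ] L2 μ) × ℂ) :=
    { carrier := {p | ∃ f : Lp ℂ ∞ μ, Integrable f μ ∧ mulOp μ f = p.1 ∧ ∫ x, f x ∂μ = p.2}
      add_mem' := by
        rintro _ _ ⟨f, hf, h1, h2⟩ ⟨g, hg, h3, h4⟩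
        refine ⟨f + g, (hf.add hg).congr (Lp.coeFn_add f g).symm, ?_, ?_⟩
        · rw [mulOp_add, h1, h3]
          rfl
        · rw [integral_congr_ae (Lp.coeFn_add f g)]
          exact (integral_add hf hg).trans (by rw [h2, h4]; rfl)
      zero_mem' := by
        refine ⟨0, (integrable_zero G ℂ μ).congr (Lp.coeFn_zero ℂ ∞ μ).symm, mulOp_zero μ, ?_⟩
        rw [integral_congr_ae (Lp.coeFn_zero ℂ ∞ μ)]
        exact integral_zero _ _
      smul_mem' := by
        rintro c _ ⟨f, hf, h1, h2⟩
        refine ⟨c • f, (hf.smul c).congr (Lp.coeFn_smul c f).symm, ?_, ?_⟩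
        · rw [mulOp_smul, h1]
          rfl
        · rw [integral_congr_ae (Lp.coeFn_smul c f)]
          exact (integral_smul c f).trans (by rw [h2]; rfl) }
  refine HasWeight.of_relation R ?_ ?_ hT ⟨f, hf, rfl, rfl⟩
  · rintro v ⟨g, hg, h1, h2⟩
    have h3 := ae_eq_of_mulOp_eq μ hg ((integrable_zero G ℂ μ).congr (Lp.coeFn_zero ℂ ∞ μ).symm)
      (h1.trans (mulOp_zero μ).symm)
    rw [← show _ = v from h2, integral_congr_ae (h3.trans (Lp.coeFn_zero ℂ ∞ μ))]
    exact integral_zero _ _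
  · intro S _ hS hw
    simp only [haarWeight, iInf_lt_iff] at hw
    obtain ⟨g, rfl, hg⟩ := hw
    have hgi : Integrable g μ := ⟨Lp.aestronglyMeasurable g, hg⟩
    refine ⟨g, hgi, rfl, ?_⟩
    rw [haarWeight_eq μ hgi]
    exact integral_eq_of_isPositive μ hgi hS

/-- A cutoff `χ` equal to `1` on the support writes `π_a` as `π_χ* π_a`; polarization then reduces
to the positive operators `π_d* π_d`. -/
theorem piOp_mem_weightDomain (a : C_c(G, ℂ)) :
    piOp μ a ∈ weightDomain (algM μ) (haarWeight μ) := by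
  obtain ⟨χ, h1, h2⟩ := exists_mul_eq_self a
  have h3 : piOp μ a = star (piOp μ χ) * piOp μ a := by
    rw [star_piOp, h1, ← piOp_mul]
    congr 1
    ext x
    exact (h2 x).symm
  rw [h3]
  let P : Submodule ℂ (L2 μ →L[ℂ] L2 μ) := LinearMap.range
    { toFun := piOp μ, map_add' := piOp_add μ, map_smul' := piOp_smul μ : C_c(G, ℂ) →ₗ[ℂ] _ }
  refine star_mul_mem_of_star_mul_self_mem (P := P) ?_ ⟨χ, rfl⟩ ⟨a, rfl⟩
  rintro _ ⟨d, rfl⟩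
  refine Submodule.subset_span ⟨?_, ContinuousLinearMap.isPositive_adjoint_comp_self _, ?_⟩
  · change star (piOp μ d) * piOp μ d ∈ _
    rw [star_piOp, ← piOp_mul]
    exact ⟨_, rfl⟩
  · change haarWeight μ (star (piOp μ d) * piOp μ d) < ∞
    rw [star_piOp, ← piOp_mul]
    refine (haarWeight_le μ _).trans_lt ?_
    exact ((integrable_Cc μ (star d * d)).congr (MemLp.coeFn_toLp _).symm).2

theorem hasPhi_piOp (a : C_c(G, ℂ)) : HasPhi μ (piOp μ a) (∫ x, a x ∂μ) := by
  have hm := a.continuous.memLp_top_of_hasCompactSupport a.hasCompactSupport μ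
  have h := hasPhi_of_integrable μ ((integrable_Cc μ a).congr hm.coeFn_toLp.symm)
    (piOp_mem_weightDomain μ a)
  rw [integral_congr_ae hm.coeFn_toLp] at h
  exact h

end

/-! ### Slices by the weights, Fourier transforms and the dual pairing -/

section

variable {G : Type*} [Group G] [TopologicalSpace G] [IsTopologicalGroup G] [LocallyCompactSpace G]
  [T2Space G] [MeasurableSpace G] [BorelSpace G]
variable (μ : Measure G) [μ.IsHaarMeasure] [μ.Regular]

theorem bmul_mul_piOp (c : G →ᵇ ℂ) (a : C_c(G, ℂ)) :
    bmul μ c * piOp μ a = piOp μ a * bmul μ c := by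
  ext1 ξ
  apply Lp.ext
  filter_upwards [coeFn_bmul μ c (piOp μ a ξ), coeFn_piOp μ a ξ, coeFn_piOp μ a (bmul μ c ξ),
    coeFn_bmul μ c ξ] with x h1 h2 h3 h4
  rw [mul_apply_eq_comp, mul_apply_eq_comp, h1, h2, h3, h4, mul_left_comm]

theorem inner_tmul_star_multUnitary (B : L2 μ →L[ℂ] L2 μ) (ξ η ξ' η' : L2 μ) :
    ⟪tmul ξ η, (star (multUnitary μ) * tensorOp 1 B) (tmul ξ' η')⟫_ℂ =
      ⟪ξ, bmul μ (coef μ η (B η')) ξ'⟫_ℂ := by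
  rw [mul_apply_eq_comp, ContinuousLinearMap.star_eq_adjoint,
    ContinuousLinearMap.adjoint_inner_right, tensorOp_tmul]
  exact inner_multUnitary_tmul μ ξ η ξ' (B η')

theorem inner_tmul_tensorOp_mul_star_multUnitary (A B : L2 μ →L[ℂ] L2 μ) (ξ η ξ' η' : L2 μ) :
    ⟪tmul ξ η, (tensorOp A 1 * star (multUnitary μ) * tensorOp 1 B) (tmul ξ' η')⟫_ℂ =
      ⟪ξ, A (bmul μ (coef μ η (B η')) ξ')⟫_ℂ := by
  have h1 : (1 : L2 μ →L[ℂ] L2 μ).adjoint η = η := by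
    rw [← ContinuousLinearMap.star_eq_adjoint, star_one]
    rfl
  have h2 := inner_tmul_star_multUnitary μ B (A.adjoint ξ) η ξ' η'
  rw [ContinuousLinearMap.adjoint_inner_left] at h2
  rw [mul_assoc, mul_apply_eq_comp, ← h2, ← ContinuousLinearMap.adjoint_inner_left,
    adjoint_tensorOp_tmul, h1]

/-- A criterion for `Z = (φ ⊗ id)(X)` when the slices `(id ⊗ θ)(X)` are given by functions. -/
theorem isSlicePhi_of_slices {X : L2L2 μ →L[ℂ] L2L2 μ} {Z : L2 μ →L[ℂ] L2 μ} (hZ : Z ∈ algMhat μ)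
    (a : C_c(G, ℂ)) (k : L2 μ → L2 μ → (G →ᵇ ℂ)) {C : ℝ}
    (hk : ∀ β κ, ‖k β κ‖ ≤ ‖β‖ * ‖κ‖ * C)
    (hX : ∀ ξ β η κ, ⟪tmul ξ β, X (tmul η κ)⟫_ℂ = ⟪ξ, (piOp μ a * bmul μ (k β κ)) η⟫_ℂ)
    (hkZ : ∀ β κ, ∫ x, a x * k β κ x ∂μ = ⟪β, Z κ⟫_ℂ) : IsSlicePhi μ X Z := by
  -- The functions `k (bra n) (ket n)` sum uniformly to `c`, so every slice is `π` of a function in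
  -- `C_c(G)`. Thus no `θ` is excluded from the domain, and vector functionals already separate
  -- points.
  have key : ∀ θ : NormalFunctional μ, ∃ c : G →ᵇ ℂ, θ.sliceRight X = piOp μ (mulCc a c) ∧
      ∫ x, a x * c x ∂μ = θ.eval Z := fun θ => by
    have hs : Summable fun n => k (θ.bra n) (θ.ket n) :=
      Summable.of_norm_bounded (θ.summable_mul_norm.mul_right C) fun n => hk _ _
    refine ⟨∑' n, k (θ.bra n) (θ.ket n), ?_, ?_⟩
    · rw [piOp_mulCc]
      refine opext_inner μ fun ξ η => ?_
      refine (θ.hasSum_inner_sliceRight X ξ η).unique ?_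
      have h := hs.hasSum.mapL (innerSL ℂ ξ ∘L piOp μ a ∘L
        ContinuousLinearMap.apply ℂ (L2 μ) η ∘L bmulL μ)
      exact h.congr_fun fun n => hX _ _ _ _
    · rw [← integralMulL_apply]
      refine (hs.hasSum.mapL (integralMulL μ a)).unique ((θ.hasSum_eval Z).congr_fun fun n => ?_)
      rw [integralMulL_apply, hkZ]
  refine ⟨hZ, fun θ _ => ?_, fun T _ hT => opext_inner μ fun ξ η => ?_⟩
  · obtain ⟨c, h1, h2⟩ := key θ
    rw [h1, ← h2]
    exact hasPhi_piOp μ (mulCc a c)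
  · have h := hT (NormalFunctional.single η ξ) (by
      obtain ⟨c, h1, -⟩ := key (NormalFunctional.single η ξ)
      rw [h1]
      exact piOp_mem_weightDomain μ _)
    rw [NormalFunctional.single_eval] at h
    rw [h, zero_apply, inner_zero_right]

theorem inner_star_convOp_mul (c : C_c(G, ℂ)) (B : L2 μ →L[ℂ] L2 μ) (ξ η : L2 μ) :
    ⟪ξ, (star (convOp μ c) * B) η⟫_ℂ = ∫ x, star (c x) * coef μ ξ (B η) x ∂μ := by
  rw [mul_apply_eq_comp, ContinuousLinearMap.star_eq_adjoint,
    ContinuousLinearMap.adjoint_inner_right]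
  exact inner_convOp_left μ c ξ (B η)

/-- A criterion for `A π_b = (id ⊗ φ̂)(X)`, where `X = (A ⊗ 1) W* (1 ⊗ L_b)`. -/
theorem isSlicePhihat_of_slices {X : L2L2 μ →L[ℂ] L2L2 μ} {A : L2 μ →L[ℂ] L2 μ} (b : C_c(G, ℂ))
    (hA : A * piOp μ b ∈ algM μ) (hA' : ∀ g, ∃ g', A.adjoint (vec μ g) = vec μ g')
    (hX : ∀ ξ β η κ, ⟪tmul ξ β, X (tmul η κ)⟫_ℂ = ⟪ξ, A (bmul μ (coef μ β (convOp μ b κ)) η)⟫_ℂ) :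
    IsSlicePhihat μ X (A * piOp μ b) := by
  refine ⟨hA, fun ω hω => hasPhihat_of_tendsto μ hω ?_, fun T _ hT => opext_vec μ fun g k => ?_⟩
  · have h1 : Tendsto (fun e => A * bmulL μ (coef μ (vec μ e) (convOp μ b (vec μ e)))) (bumps μ)
        (𝓝 (A * bmulL μ (toBCF b))) :=
      (((bmulL μ).continuous.tendsto _).comp (tendsto_coef_convOp μ b)).const_mul A
    refine ((ω.continuous_eval.tendsto _).comp h1).congr fun e => ?_
    refine (ω.hasSum_eval _).unique ((ω.hasSum_inner_sliceLeft X _ _).congr_fun fun n => ?_)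
    exact (hX _ _ _ _).symm
  · have h : (NormalFunctional.single (vec μ k) (vec μ g)).sliceLeft X ∈
        weightDomain (algMhat μ) (plancherelWeight μ) := by
      obtain ⟨g', hg'⟩ := hA' g
      convert star_convOp_mul_convOp_mem μ (star k * g') b using 1
      refine opext_inner μ fun ξ η => ?_
      rw [NormalFunctional.inner_single_sliceLeft, hX, ← ContinuousLinearMap.adjoint_inner_left,
        hg', inner_vec_bmul_vec, inner_star_convOp_mul]
      refine integral_congr_ae (Eventually.of_forall fun x => ?_)
      simp only [CompactlySupportedContinuousMap.mul_apply,
        CompactlySupportedContinuousMap.star_apply, star_mul', star_star]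
      ring
    have h1 := hT _ h
    rw [NormalFunctional.single_eval] at h1
    rw [h1, zero_apply, inner_zero_right]

theorem adjoint_piOp_vec (a g : C_c(G, ℂ)) : (piOp μ a).adjoint (vec μ g) = vec μ (star a * g) := by
  rw [← ContinuousLinearMap.star_eq_adjoint, star_piOp, piOp_vec]

theorem piOp_mem_algM (a : C_c(G, ℂ)) : piOp μ a ∈ algM μ := ⟨_, rfl⟩

theorem isInvFourier_convOp (b : C_c(G, ℂ)) : IsInvFourier μ (convOp μ b) (piOp μ b) := by
  have h := isSlicePhihat_of_slices μ (A := 1) b (by rw [one_mul]; exact piOp_mem_algM μ b)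
    (fun g => ⟨g, by rw [← ContinuousLinearMap.star_eq_adjoint, star_one]; rfl⟩)
    fun ξ β η κ => inner_tmul_star_multUnitary μ (convOp μ b) ξ β η κ
  rwa [one_mul] at h

theorem isSlicePhihat_tensor (a b : C_c(G, ℂ)) :
    IsSlicePhihat μ (tensorOp (piOp μ a) 1 * star (multUnitary μ) * tensorOp 1 (convOp μ b))
      (piOp μ a * piOp μ b) :=
  isSlicePhihat_of_slices μ b (by rw [← piOp_mul]; exact piOp_mem_algM μ _)
    (fun g => ⟨_, adjoint_piOp_vec μ a g⟩)
    fun ξ β η κ => inner_tmul_tensorOp_mul_star_multUnitary μ (piOp μ a) (convOp μ b) ξ β η κ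

/-- Weakly, `(L_{star a})* = ∫ a(x) λ_x* dx`, which is the slice of `W*` by `a(x) dx`. -/
theorem isSlicePhi_tensor (a b : C_c(G, ℂ)) :
    IsSlicePhi μ (tensorOp (piOp μ a) 1 * star (multUnitary μ) * tensorOp 1 (convOp μ b))
      (star (convOp μ (star a)) * convOp μ b) := by
  refine isSlicePhi_of_slices μ (mul_mem (star_mem (convOp_mem_algMhat μ _))
    (convOp_mem_algMhat μ b)) a (fun β κ => coef μ β (convOp μ b κ)) (C := ‖convOp μ b‖) ?_
    (fun ξ β η κ => inner_tmul_tensorOp_mul_star_multUnitary μ (piOp μ a) (convOp μ b) ξ β η κ) ?_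
  · intro β κ
    refine (norm_coef_le μ _ _).trans ?_
    rw [mul_assoc, mul_comm ‖κ‖]
    exact mul_le_mul_of_nonneg_left ((convOp μ b).le_opNorm κ) (norm_nonneg _)
  · intro β κ
    rw [inner_star_convOp_mul]
    refine integral_congr_ae (Eventually.of_forall fun x => ?_)
    simp only [CompactlySupportedContinuousMap.star_apply, star_star]

theorem isFourier_piOp (a : C_c(G, ℂ)) : IsFourier μ (piOp μ a) (convOp μ a) := by
  refine isSlicePhi_of_slices μ (convOp_mem_algMhat μ a) a (fun β κ => star (coef μ κ β)) (C := 1)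
    ?_ ?_ ?_
  · intro β κ
    rw [norm_star, mul_one, mul_comm]
    exact norm_coef_le μ _ _
  · intro ξ β η κ
    rw [mul_apply_eq_comp, tensorOp_tmul, ← bmul_mul_piOp]
    exact inner_tmul_multUnitary μ ξ β (piOp μ a η) κ
  · intro β κ
    rw [inner_convOp]
    simp only [star_coef_apply]

theorem inner_sliceLeft_multUnitary (ω : NormalFunctional μ) (ξ η : L2 μ) :
    ⟪ξ, ω.sliceLeft (multUnitary μ) η⟫_ℂ = ω.eval (bmul μ (star (coef μ η ξ))) :=
  (ω.hasSum_inner_sliceLeft _ ξ η).unique ((ω.hasSum_eval _).congr_fun fun n =>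
    inner_tmul_multUnitary μ (ω.bra n) ξ (ω.ket n) η)

theorem exists_sliceLeft_eq_convOp (b : C_c(G, ℂ)) :
    ∃ ω : NormalFunctional μ, ω.sliceLeft (multUnitary μ) = convOp μ b := by
  obtain ⟨χ, h1, h2⟩ := exists_mul_eq_self b
  -- Since `χ b = b`, this vector functional takes multiplication by `c` to `∫ b c`.
  refine ⟨.single (vec μ b) (vec μ χ), opext_inner μ fun ξ η => ?_⟩
  rw [inner_sliceLeft_multUnitary, NormalFunctional.single_eval, inner_vec_bmul_vec, inner_convOp]
  refine integral_congr_ae (Eventually.of_forall fun x => ?_)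
  have h3 := DFunLike.congr_fun h1 x
  rw [CompactlySupportedContinuousMap.star_apply] at h3
  simp only [h3, star_coef_apply]
  rw [mul_left_comm, h2, mul_comm]

/-- The slice of `W` records `ω` only on conjugates of coefficient functions, where it must agree
with integration against `b`. The function `a` is a uniform limit of such conjugates, and both
functionals are continuous, so the value does not depend on the choice of `ω`. -/
theorem eval_piOp_of_sliceLeft_eq {b : C_c(G, ℂ)} {ω : NormalFunctional μ}
    (hω : ω.sliceLeft (multUnitary μ) = convOp μ b) (a : C_c(G, ℂ)) :
    ω.eval (piOp μ a) = ∫ x, a x * b x ∂μ := by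
  have h1 : ∀ ξ η, ω.eval (bmulL μ (star (coef μ η ξ))) = integralMulL μ b (star (coef μ η ξ)) := by
    intro ξ η
    rw [bmulL_apply, ← inner_sliceLeft_multUnitary, hω, inner_convOp, integralMulL_apply]
    simp only [star_coef_apply]
  have h2 := (continuous_star.tendsto _).comp (tendsto_coef_vec μ (star a))
  have h3 : star (toBCF (star a)) = toBCF a := by
    ext x
    exact star_star _
  rw [h3] at h2
  have h4 := ((ω.continuous_eval.comp (bmulL μ).continuous).tendsto _).comp h2
  have h5 := tendsto_nhds_unique (h4.congr fun e => h1 _ _)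
    (((integralMulL μ b).continuous.tendsto _).comp h2)
  refine h5.trans ?_
  rw [integralMulL_apply]
  simp only [toBCF_apply, mul_comm]

theorem hasDualPairing_convOp_piOp (a b : C_c(G, ℂ)) :
    HasDualPairing μ (convOp μ b) (piOp μ a) (∫ x, a x * b x ∂μ) := by
  refine ⟨exists_sliceLeft_eq_convOp μ b, fun ω hω => ?_⟩
  have h := eval_piOp_of_sliceLeft_eq μ hω a
  refine ⟨h, fun θ hθ => ?_⟩
  have h1 : ω.evalTensor θ (multUnitary μ) = ∫ x, a x * b x ∂μ := by
    rw [ω.evalTensor_eq_eval_sliceRight, hθ, h]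
  refine ⟨h1, ?_⟩
  rw [← h1, ω.evalTensor_eq_eval_sliceLeft, hω]

end

end LCQG

end

theorem mainTheorem10 {G : Type*} [Group G] [TopologicalSpace G] [IsTopologicalGroup G]
    [LocallyCompactSpace G] [T2Space G] [MeasurableSpace G] [BorelSpace G]
    (μ : Measure G) [μ.IsHaarMeasure] [μ.Regular] (a b : C_c(G, ℂ)) :
    LCQG.HasDualPairing μ (LCQG.convOp μ b) (LCQG.piOp μ a) (∫ x, a x * b x ∂μ) ∧
    LCQG.HasPhiTensorPhihat μ
      (LCQG.tensorOp (LCQG.piOp μ a) 1 * star (LCQG.multUnitary μ) *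
        LCQG.tensorOp 1 (LCQG.convOp μ b))
      (∫ x, a x * b x ∂μ) ∧
    (∃ Y, LCQG.IsInvFourier μ (LCQG.convOp μ b) Y ∧
      LCQG.HasPhi μ (LCQG.piOp μ a * Y) (∫ x, a x * b x ∂μ)) ∧
    (∃ Z, LCQG.IsFourier μ (star (LCQG.piOp μ a)) Z ∧
      LCQG.HasPhihat μ (star Z * LCQG.convOp μ b) (∫ x, a x * b x ∂μ)) := by
  have hφ : LCQG.HasPhi μ (LCQG.piOp μ a * LCQG.piOp μ b) (∫ x, a x * b x ∂μ) := by
    rw [← LCQG.piOp_mul]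
    exact LCQG.hasPhi_piOp μ (a * b)
  have hφhat : LCQG.HasPhihat μ (star (LCQG.convOp μ (star a)) * LCQG.convOp μ b)
      (∫ x, a x * b x ∂μ) := by
    have h := LCQG.hasPhihat_star_convOp_mul μ (star a) b
    simpa only [CompactlySupportedContinuousMap.star_apply, star_star] using h
  refine ⟨LCQG.hasDualPairing_convOp_piOp μ a b,
    ⟨⟨_, LCQG.isSlicePhihat_tensor μ a b, hφ⟩, ⟨_, LCQG.isSlicePhi_tensor μ a b, hφhat⟩⟩,
    ⟨_, LCQG.isInvFourier_convOp μ b, hφ⟩, ⟨_, ?_, hφhat⟩⟩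
  rw [LCQG.star_piOp]
  exact LCQG.isFourier_piOp μ (star a)
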